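/- Let $G=(V,E)$ be a finite simple graph with $n$ vertices and maximum degree at most $\Delta$, where $\Delta\ge 2$. Let $T=(T_v)_{v\in V}$ be a complex tensor network on $G$ without open indices and with bond dimension $\chi$ (so $T_v$ has one index in $\{1,\dots,\chi\}$ for each neighbour of $v$), and for every network let $\mathcal Z(\cdot)$ be its full contraction. Let $(\mu_{v\to w})$ be a belief-propagation (BP) fixed point: vectors $\mu_{v\to w}\in\mathbb C^\chi$ such that contracting $T_v$ with all incoming messages except the one from $w$ gives a scalar multiple of $\mu_{v\to w}$, for all adjacent $v,w$. Assume $I_{vw}=\sum_i\mu_{v\to w}(i)\,\mu_{w\to v}(i)\neq0$ on every edge and $Z^{(v)}\ne0$ at every vertex, where $Z^{(v)}$ is the contraction of $T_v$ with the vectors $\mu_{w\to v}/\sqrt{I_{vw}}$ (principal square root) over all neighbours $w$ of $v$, and let $\tilde T_v=T_v/Z^{(v)}$ be the network normalized at the BP fixed point. On each edge $vw$ split the identity as $\mathbb 1=\mathcal P_{vw}+\mathcal P^\perp_{vw}$, where $\mathcal P_{vw}$ is the rank-one operator that feeds $\mu_{w\to v}$ into $\tilde T_v$ and $\mu_{v\to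 w}$ into $\tilde T_w$, divided by $I_{vw}$. A connected loop $l$ is a connected subgraph of $G$ in which every vertex has degree at least two; $|l|$ is its number of edges, and its correction $Z_l$ is the contraction of $\tilde T$ with $\mathcal P^\perp$ on the edges of $l$ and $\mathcal P$ on all other edges. A cluster $\mathbf W$ is a finite multiset of connected loops $l_i$ with multiplicities $\eta_i$; put $|\mathbf W|=\sum_i\eta_i|l_i|$, $\mathbf W!=\prod_i\eta_i!$ and $Z_{\mathbf W}=\prod_iZ_{l_i}^{\eta_i}$. Its interaction graph $G_{\mathbf W}$ has $\eta_i$ vertices for each $l_i$, and two distinct vertices are joined when their loops are equal or share a vertex of $G$; $\mathbf W$ is connected if $G_{\mathbf W}$ is connected (and non-empty). The Ursell function is $\phi(\mathbf W)=\frac1{\mathbf W!}\sum_C(-1)^{|E(C)|}$, the sum being over the connected spanning subgraphs $C$ of $G_{\mathbf W}$. Let $\tilde F_m=\sum_{\mathbf W\text{ connected},\,|\mathbf W|\le m}\phi(\mathbf W)Z_{\mathbf W}$. Suppose there is a real number $c>\log(2(\Delta-1))+\frac12$ with $|Z_l|\le e^{-c|l|}$ for every connected loop $l$, and put $d=c-\log(2(\Delta-1))-\frac12$.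 Then the cluster series $\sum_{\mathbf W\text{ connected}}\phi(\mathbf W)Z_{\mathbf W}$ converges absolutely, its sum is $\log\mathcal Z(\tilde T)$, and for every integer $m\ge0$ $$\bigl|\log \mathcal Z(\tilde T)-\tilde F_m\bigr|\le n\,e^{-d(m+1)} .$$ Here $\log\mathcal Z(\tilde T)$ is the logarithm of $\mathcal Z(\tilde T)$ obtained by continuing the value $0$ continuously along $t\in[0,1]$, as each $\mathcal P^\perp$ is replaced by $t\,\mathcal P^\perp$ (at $t=0$ the contraction is the BP vacuum $1$, at $t=1$ it is $\mathcal Z(\tilde T)$); it is part of the claim that this logarithm exists and is unique. If all $Z_l$ are real, then $\mathcal Z(\tilde T)>0$ and $\log \mathcal Z(\tilde T)$ is its ordinary real logarithm. -/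

import Mathlib

open scoped Nat

namespace TensorNet

noncomputable section

variable {V : Type*} [Fintype V] [DecidableEq V] {G : SimpleGraph V} [DecidableRel G.Adj] {χ : ℕ}

/-- A tensor network without open indices on the graph `G`, with bond dimension `χ`: at each vertex
`v` a complex tensor with one index in `Fin χ` for each neighbour of `v`. -/
abbrev Network (G : SimpleGraph V) (χ : ℕ) : Type _ :=
  (v : V) → (G.neighborSet v → Fin χ) → ℂ

/-- A family of messages: `μ v w` is the message sent from `v` to `w`. Only the values at adjacent
`v`, `w` are ever used. -/
abbrev Messages (V : Type*) (χ : ℕ) : Type _ := V → V → Fin χ → ℂ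

/-- The partition function: the full contraction of the network, one summed index per edge. -/
def partitionFunction (T : Network G χ) : ℂ :=
  ∑ x : G.edgeSet → Fin χ, ∏ v, T v (fun w => x ⟨s(v, w), G.mem_edgeSet.2 w.2⟩)

/-- Self-consistency of the messages: contracting `T v` with all incoming messages except the one
from `w` returns the outgoing message from `v` to `w`, up to a scalar. -/
def IsBPFixedPoint (T : Network G χ) (μ : Messages V χ) : Prop :=
  ∀ (v : V) (w : G.neighborSet v), ∃ r : ℂ, ∀ i : Fin χ,
    (∑ x : G.neighborSet v → Fin χ with x w = i,
      T v x * ∏ u ∈ Finset.univ.erase w, μ u v (x u)) = r * μ v w i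

/-- `I_{vw}`, the bilinear pairing (no complex conjugation) of the two messages on an edge. -/
def overlap (μ : Messages V χ) (v w : V) : ℂ := ∑ i, μ v w i * μ w v i

/-- The local contribution `Z^{(v)}`: `T v` contracted with all incoming messages, each divided by
the principal square root of `I_{vw}`. -/
def localContribution (T : Network G χ) (μ : Messages V χ) (v : V) : ℂ :=
  ∑ x : G.neighborSet v → Fin χ,
    T v x * ∏ w : G.neighborSet v, (μ w v (x w) / (overlap μ v w) ^ (1 / 2 : ℂ))

/-- The network normalized by the messages, `T v / Z^{(v)}`. -/
def normalize (T : Network G χ) (μ : Messages V χ) : Network G χ :=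
  fun v x => T v x / localContribution T μ v

/-- The rank-one (vacuum) part of the identity on the edge `vw`. The row index is contracted with
the tensor at `v`, which receives the message from `w`; the column index with the tensor at `w`. -/
def vacuumOp (μ : Messages V χ) (v w : V) : Matrix (Fin χ) (Fin χ) ℂ :=
  Matrix.of fun i j => μ w v i * μ v w j / overlap μ v w

/-- The complementary projector (excited edge). -/
def excitedOp (μ : Messages V χ) (v w : V) : Matrix (Fin χ) (Fin χ) ℂ := 1 - vacuumOp μ v w

/-- An orientation of the edge `e`. -/
def edgeDart (e : G.edgeSet) : G.Dart :=
  ⟨Quot.out e.1, G.mem_edgeSet.1 (by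
    have h : s((Quot.out e.1).1, (Quot.out e.1).2) = e.1 := Quot.out_eq e.1
    rw [h]; exact e.2)⟩

/-- Contraction of the network with the matrix `M v w` inserted on each edge `vw`, where the row
index is joined to `T v` and the column index to `T w`. It is only used for `M` with
`M w v = (M v w)ᵀ`, for which the orientations do not matter. -/
def contractWith (T : Network G χ) (M : V → V → Matrix (Fin χ) (Fin χ) ℂ) : ℂ :=
  ∑ x : (v : V) → G.neighborSet v → Fin χ, (∏ v, T v (x v)) *
    ∏ e : G.edgeSet, M (edgeDart e).fst (edgeDart e).snd
      (x (edgeDart e).fst ⟨(edgeDart e).snd, (edgeDart e).adj⟩)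
      (x (edgeDart e).snd ⟨(edgeDart e).fst, (edgeDart e).adj.symm⟩)

/-- The network with each excited projector multiplied by `t`: at `t = 0` this is the vacuum
contribution, at `t = 1` every edge carries the identity. -/
def interpolatedPartition (T : Network G χ) (μ : Messages V χ) (t : ℝ) : ℂ :=
  contractWith T (fun v w => vacuumOp μ v w + (t : ℂ) • excitedOp μ v w)

/-- `z` is the logarithm of the partition function (of a network whose vacuum contribution is `1`)
on the branch that is continued from the value `0` at the vacuum. -/
def IsLogPartition (T : Network G χ) (μ : Messages V χ) (z : ℂ) : Prop :=
  ∃ L : ℝ → ℂ, ContinuousOn L (Set.Icc 0 1) ∧ L 0 = 0 ∧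
    (∀ t ∈ Set.Icc (0 : ℝ) 1, Complex.exp (L t) = interpolatedPartition T μ t) ∧ L 1 = z

/-- A generalized loop: a subgraph in which every vertex has degree at least two. -/
def IsGeneralizedLoop (C : G.Subgraph) : Prop := ∀ w ∈ C.verts, 2 ≤ (C.neighborSet w).ncard

/-- The connected generalized loops of `G`. -/
abbrev Loop (G : SimpleGraph V) : Type _ := {C : G.Subgraph // IsGeneralizedLoop C ∧ C.Connected}

/-- The weight of a loop: its number of edges. -/
def Loop.weight (l : Loop G) : ℕ := l.1.edgeSet.ncard

open Classical in
/-- The loop correction: excited projectors on the edges of the loop, vacuum on all other edges. -/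
def loopCorrection (T : Network G χ) (μ : Messages V χ) (l : Loop G) : ℂ :=
  contractWith T (fun v w => if l.1.Adj v w then excitedOp μ v w else vacuumOp μ v w)

/-- Two loops are compatible if they share no vertex (and hence no edge). -/
def Compatible (l l' : Loop G) : Prop := Disjoint l.1.verts l'.1.verts

/-- Clusters: finite collections of connected loops with multiplicities. -/
abbrev Cluster (G : SimpleGraph V) : Type _ := Loop G →₀ ℕ

namespace Cluster

/-- The cluster weight. -/
def weight (W : Cluster G) : ℕ := W.sum fun l k => k * l.weight

/-- The product of the factorials of the multiplicities. -/
def fact (W : Cluster G) : ℕ := W.prod fun _ k => k !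

/-- The cluster correction. -/
def correction (T : Network G χ) (μ : Messages V χ) (W : Cluster G) : ℂ :=
  W.prod fun l k => loopCorrection T μ l ^ k

/-- Vertices of the interaction graph: each loop occurs as often as its multiplicity says. -/
abbrev Vert (W : Cluster G) : Type _ := (l : W.support) × Fin (W l)

/-- The interaction graph. -/
def interactionGraph (W : Cluster G) : SimpleGraph W.Vert where
  Adj p q := p ≠ q ∧ (p.1 = q.1 ∨ ¬ Compatible p.1.1 q.1.1)
  symm := ⟨fun _ _ h => ⟨h.1.symm, h.2.imp Eq.symm fun h' hc => h' (Disjoint.symm hc)⟩⟩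
  loopless := ⟨fun _ h => h.1 rfl⟩

/-- A cluster is connected if its interaction graph is (in particular it is not empty). -/
def IsConnected (W : Cluster G) : Prop := W.interactionGraph.Connected

open Classical in
/-- The Ursell function: the sum of `(-1)^|E|` over the edge sets `E` of the connected spanning
subgraphs of the interaction graph, divided by the product of the factorials. -/
def ursell (W : Cluster G) : ℂ :=
  (1 / (W.fact : ℂ)) * ∑ E ∈ Finset.univ.filter (fun E : Finset (Sym2 W.Vert) =>
    (∀ e ∈ E, e ∈ W.interactionGraph.edgeSet) ∧
      (SimpleGraph.fromEdgeSet {e | e ∈ E}).Connected), (-1 : ℂ) ^ Finset.card E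

end Cluster

set_option linter.unusedSectionVars false in
theorem Loop.weight_pos (l : Loop G) : 0 < l.weight := by
  obtain ⟨C, hC, hc⟩ := l
  obtain ⟨w, hw⟩ := hc.nonempty
  have h2 := hC w hw
  obtain ⟨u, hu⟩ : (C.neighborSet w).Nonempty := by
    rw [← Set.ncard_pos]; omega
  have : (C.edgeSet).Nonempty := ⟨s(w, u), hu⟩
  exact (Set.ncard_pos (Set.toFinite _)).2 this

set_option linter.unusedSectionVars false in
theorem Cluster.finite_weight_le (m : ℕ) : {W : Cluster G | W.weight ≤ m}.Finite := by
  classical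
  have hle : ∀ W : Cluster G, W.weight ≤ m → ∀ l, W l ≤ m := by
    intro W hW l
    by_cases hl : l ∈ W.support
    · have h1 : W l * l.weight ≤ W.weight :=
        Finset.single_le_sum (f := fun l => W l * l.weight) (fun _ _ => Nat.zero_le _) hl
      have h2 := Nat.le_mul_of_pos_right (W l) l.weight_pos
      omega
    · rw [Finsupp.notMem_support_iff.1 hl]; exact Nat.zero_le _
  have hfin : {f : Loop G → ℕ | ∀ l, f l ∈ Set.Iic m}.Finite :=
    Set.Finite.pi' fun _ => Set.finite_Iic m
  exact Set.Finite.of_finite_image (f := fun W : Cluster G => (W : Loop G → ℕ))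
    (hfin.subset (by rintro _ ⟨W, hW, rfl⟩; exact fun l => hle W hW l))
    (DFunLike.coe_injective.injOn)

open Classical in
/-- The cluster expansion truncated at cluster weight `m`. -/
def truncatedExpansion (T : Network G χ) (μ : Messages V χ) (m : ℕ) : ℂ :=
  ∑ W ∈ (Cluster.finite_weight_le (G := G) m).toFinset with W.IsConnected,
    W.ursell * W.correction T μ

end

end TensorNet

/-!
The proof turns the tensor network into a hard-core gas of connected loops and controls the cluster
expansion of that gas.

*Gas of loops.* Expand `vacuumOp + t • excitedOp` on every edge: the interpolated partition function
is the sum over edge sets `F` of `t ^ |F|` times the contraction with excited edges `F`. By the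
fixed-point equation, a tensor that is fed with vacuum messages on all edges but one sends out a
multiple of its own message, which the excited projector annihilates. So only those `F` contribute
in which no vertex has degree one (`edgeContraction_eq_zero`). Since the vacuum projector has rank
one, contractions over vertex-disjoint edge sets factorize (`edgeContraction_mul`), and the
normalization makes the vacuum contribution `1` (`edgeContraction_empty`). Hence the partition
function is the sum over sets of pairwise disjoint loops of the products of their corrections
(`interpolatedPartition_eq_gas`).

*Formal logarithm.* The Ursell coefficients are the Taylor coefficients of the logarithm of the
partition function of a hard-core gas. Sorting edge sets of the interaction graph by the component
of a root shows `∂Ξ = ∂(log Ξ) · Ξ` coefficient by coefficient (`sum_powerset_edges_eq`,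
`indep_coeff_eq`). It follows that the series of clusters rooted at a polymer `x` is the exponential
of minus the series of clusters that touch `x`; in differentiated form this is `euler_rootedSeries`.

*Convergence.* Taking absolute values in the last identity, truncating by degree and integrating the
resulting differential inequality gives a recursion for the rooted clusters (`sum_rooted_le_exp`).
Under the Kotecký–Preiss condition `∑_{l' ≁ l} ρ_{l'} e^{a_{l'}} ≤ a_l` it closes, and bounds the
clusters rooted at `l` by `e^{a_l}` (`sum_rooted_le`). An absolutely convergent cluster series is
continuous along the interpolation and is a logarithm of the partition function, because both sides
solve the same linear differential equation (`exp_tsum_cluster`).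

*Counting loops.* With `D = Δ - 1`, `ρ_l = (2 D √e) ^ (-|l|)` and `a_l = |V(l)| / 2`, the condition
reduces to the bound `1 / 2` on the sum of `ρ_l e^{a_l}` over the loops through one vertex
(`sum_loops_through_le`). To prove it, a loop is explored vertex by vertex, revealing at each step
all its remaining edges at one vertex. As every vertex has degree at least two, a vertex reached by
a single edge must have a further one, which saves a factor `2` per vertex
(`continuationSum_le`, `sum_continues_root_le`).

Summing over the vertices bounds the whole majorant series by `n` (`summable_cluster_majorant`).
The loop corrections are smaller than `ρ_l` by a factor `e^{-d |l|}`, so that the clusters of weight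
at least `m + 1` contribute at most `n e^{-d (m + 1)}`. The logarithm is unique because two
continuous logarithms of the same function differ by a continuous function with values in the
countable set `2πiℤ` (`eq_of_exp_eq`); it is real for real loop corrections, since the Ursell
coefficients are real.
-/

namespace TensorNet

open Finset

/-! ### Signed sums over connected spanning subgraphs -/

section Graph

variable {α β : Type*}

/-- The vertices reachable from `p` along the edges in `E`, as the intersection of all sets that
contain `p` and are closed under adjacency. This form of connectedness transports along embeddings
without any reference to walks. -/
def reach (E : Finset (Sym2 α)) (p : α) : Set α :=
  {a | ∀ S : Set α, p ∈ S → (∀ a b, s(a, b) ∈ E → a ∈ S → b ∈ S) → a ∈ S}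

theorem self_mem_reach (E : Finset (Sym2 α)) (p : α) : p ∈ reach E p := fun _ h _ => h

theorem reach_closed {E : Finset (Sym2 α)} {p a b : α} (h : s(a, b) ∈ E) (ha : a ∈ reach E p) :
    b ∈ reach E p := fun S h1 h2 => h2 a b h (ha S h1 h2)

theorem mem_edge_iff_of_reach {E : Finset (Sym2 α)} {p : α} {e : Sym2 α} (he : e ∈ E) :
    (∀ a ∈ e, a ∈ reach E p) ∨ (∀ a ∈ e, a ∉ reach E p) := by
  induction e with
  | h a b =>
    by_cases ha : a ∈ reach E p
    · left
      intro c hc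
      rcases Sym2.mem_iff.1 hc with rfl | rfl
      · exact ha
      · exact reach_closed he ha
    · right
      intro c hc
      rcases Sym2.mem_iff.1 hc with rfl | rfl
      · exact ha
      · exact fun hb => ha (reach_closed (Sym2.eq_swap ▸ he) hb)

theorem fromEdgeSet_connected_iff (E : Finset (Sym2 β)) (p : β) :
    (SimpleGraph.fromEdgeSet {e | e ∈ E}).Connected ↔ ∀ b, b ∈ reach E p := by
  constructor
  · intro h b S hp hS
    have key : ∀ a b : β, (SimpleGraph.fromEdgeSet {e | e ∈ E}).Walk a b → a ∈ S → b ∈ S := by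
      intro a b w
      induction w with
      | nil => exact id
      | cons hadj _ ih =>
        intro ha
        rw [SimpleGraph.fromEdgeSet_adj] at hadj
        exact ih (hS _ _ hadj.1 ha)
    exact key p b (h.preconnected p b).some hp
  · intro h
    have hr : ∀ b, (SimpleGraph.fromEdgeSet {e | e ∈ E}).Reachable p b := by
      intro b
      refine h b {b | (SimpleGraph.fromEdgeSet {e | e ∈ E}).Reachable p b} (.refl _) ?_
      intro a b hab ha
      by_cases hne : a = b
      · exact hne ▸ ha
      · exact SimpleGraph.Reachable.trans ha
          (SimpleGraph.Adj.reachable ((SimpleGraph.fromEdgeSet_adj _).2 ⟨hab, hne⟩))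
    have : Nonempty β := ⟨p⟩
    exact ⟨fun a b => (hr a).symm.trans (hr b)⟩

open Classical in
/-- The edge sets of the connected spanning subgraphs of `H`. -/
noncomputable def connSets [Fintype α] (H : SimpleGraph α) : Finset (Finset (Sym2 α)) :=
  univ.filter fun E =>
    (∀ e ∈ E, e ∈ H.edgeSet) ∧ (SimpleGraph.fromEdgeSet {e | e ∈ E}).Connected

theorem mem_connSets [Fintype α] {H : SimpleGraph α} {E : Finset (Sym2 α)} :
    E ∈ connSets H ↔
      (∀ e ∈ E, e ∈ H.edgeSet) ∧ (SimpleGraph.fromEdgeSet {e | e ∈ E}).Connected := by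
  classical
  rw [connSets, mem_filter, and_iff_right (mem_univ E)]

/-- The sum of `(-1)^|E|` over the edge sets `E` of the connected spanning subgraphs of `H`. -/
noncomputable def connSum [Fintype α] (H : SimpleGraph α) : ℂ :=
  ∑ E ∈ connSets H, (-1 : ℂ) ^ card E

theorem connSum_of_isEmpty [Fintype α] [IsEmpty α] (H : SimpleGraph α) : connSum H = 0 :=
  sum_eq_zero fun _ hE => (not_isEmpty_of_nonempty α (h := (mem_connSets.1 hE).2.nonempty)
    inferInstance).elim

variable [Fintype α] [DecidableEq α] [Fintype β]

open Classical in
/-- The edges of `H` with both ends in `B`. -/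
noncomputable def edgesIn (H : SimpleGraph α) (B : Finset α) : Finset (Sym2 α) :=
  univ.filter fun e => e ∈ H.edgeSet ∧ ∀ a ∈ e, a ∈ B

open Classical in
/-- The sum of `(-1)^|E|` over the sets `E` of edges of `H` inside `B` that connect `p` with every
vertex of `B`. -/
noncomputable def connSumOn (H : SimpleGraph α) (p : α) (B : Finset α) : ℂ :=
  ∑ E ∈ (edgesIn H B).powerset with (B : Set α) ⊆ reach E p, (-1 : ℂ) ^ card E

theorem mem_edgesIn {H : SimpleGraph α} {B : Finset α} {e : Sym2 α} :
    e ∈ edgesIn H B ↔ e ∈ H.edgeSet ∧ ∀ a ∈ e, a ∈ B := by simp [edgesIn]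

open Classical in
/-- Sorting the edge sets by the component of `p`: the rooted form of the exponential formula. -/
theorem sum_powerset_edges_eq (H : SimpleGraph α) (p : α) :
    ∑ E ∈ (edgesIn H univ).powerset, (-1 : ℂ) ^ card E =
      ∑ B : Finset α with p ∈ B, connSumOn H p B *
        ∑ E ∈ (edgesIn H Bᶜ).powerset, (-1 : ℂ) ^ card E := by
  have hmaps : ∀ E ∈ (edgesIn H univ).powerset, (reach E p).toFinset ∈
      univ.filter (fun B : Finset α => p ∈ B) := by
    intro E _
    simp [self_mem_reach]
  rw [← sum_fiberwise_of_maps_to hmaps]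
  refine sum_congr rfl fun B hB => ?_
  rw [connSumOn, sum_mul_sum, ← sum_product']
  refine sum_nbij' (fun E =>
      (E.filter (fun e => ∀ a ∈ e, a ∈ B), E.filter (fun e => ∀ a ∈ e, a ∈ Bᶜ)))
    (fun E => E.1 ∪ E.2) ?_ ?_ ?_ ?_ ?_
  · intro E hE
    rw [mem_filter, mem_powerset] at hE
    obtain ⟨hE, rfl⟩ := hE
    simp only [mem_product, mem_filter, mem_powerset]
    refine ⟨⟨fun e he => ?_, ?_⟩, fun e he => ?_⟩
    · rw [mem_filter] at he
      exact mem_edgesIn.2 ⟨(mem_edgesIn.1 (hE he.1)).1, he.2⟩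
    · intro b hb
      rw [Set.coe_toFinset] at hb
      intro S hp hS
      refine (hb {a | a ∈ reach E p ∧ a ∈ S} ⟨self_mem_reach _ _, hp⟩ ?_).2
      rintro a c hac ⟨ha, haS⟩
      refine ⟨reach_closed hac ha, hS a c (mem_filter.2 ⟨hac, ?_⟩) haS⟩
      intro x hx
      rw [Set.mem_toFinset]
      rcases Sym2.mem_iff.1 hx with rfl | rfl
      exacts [ha, reach_closed hac ha]
    · rw [mem_filter] at he
      exact mem_edgesIn.2 ⟨(mem_edgesIn.1 (hE he.1)).1, he.2⟩
  · rintro ⟨E₁, E₂⟩ h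
    simp only [mem_product, mem_filter, mem_powerset] at h
    obtain ⟨⟨h1, h1'⟩, h2⟩ := h
    simp only [mem_filter, mem_powerset]
    have hpB : p ∈ B := (mem_filter.1 hB).2
    refine ⟨fun e he => ?_, ?_⟩
    · rcases mem_union.1 he with he | he
      · exact mem_edgesIn.2 ⟨(mem_edgesIn.1 (h1 he)).1, fun _ _ => mem_univ _⟩
      · exact mem_edgesIn.2 ⟨(mem_edgesIn.1 (h2 he)).1, fun _ _ => mem_univ _⟩
    · ext b
      rw [Set.mem_toFinset]
      constructor
      · intro hb
        refine hb (B : Set α) hpB ?_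
        intro a c hac ha
        rcases mem_union.1 hac with hac | hac
        · exact (mem_edgesIn.1 (h1 hac)).2 c (Sym2.mem_mk_right a c)
        · have := (mem_edgesIn.1 (h2 hac)).2 a (Sym2.mem_mk_left a c)
          exact absurd ha (mem_compl.1 this)
      · intro hb S hp hS
        exact h1' hb S hp fun a c hac ha => hS a c (mem_union_left _ hac) ha
  · intro E hE
    rw [mem_filter, mem_powerset] at hE
    obtain ⟨hE, rfl⟩ := hE
    ext e
    simp only [mem_union, mem_filter, mem_compl, Set.mem_toFinset]
    constructor
    · rintro (h | h) <;> exact h.1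
    · intro he
      rcases mem_edge_iff_of_reach (p := p) he with h | h
      exacts [Or.inl ⟨he, h⟩, Or.inr ⟨he, h⟩]
  · rintro ⟨E₁, E₂⟩ h
    simp only [mem_product, mem_filter, mem_powerset] at h
    obtain ⟨⟨h1, h1'⟩, h2⟩ := h
    have hne : ∀ e : Sym2 α, (∀ a ∈ e, a ∈ B) → ¬ ∀ a ∈ e, a ∈ Bᶜ := by
      intro e he he'
      induction e with
      | h a b =>
        exact mem_compl.1 (he' a (Sym2.mem_mk_left a b)) (he a (Sym2.mem_mk_left a b))
    ext e
    · simp only [mem_filter, mem_union]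
      constructor
      · rintro ⟨he | he, hB⟩
        · exact he
        · exact absurd (mem_edgesIn.1 (h2 he)).2 (hne e hB)
      · exact fun he => ⟨Or.inl he, (mem_edgesIn.1 (h1 he)).2⟩
    · simp only [mem_filter, mem_union]
      constructor
      · rintro ⟨he | he, hB⟩
        · exact absurd hB (hne e (mem_edgesIn.1 (h1 he)).2)
        · exact he
      · exact fun he => ⟨Or.inr he, (mem_edgesIn.1 (h2 he)).2⟩
  · intro E hE
    rw [mem_filter, mem_powerset] at hE
    obtain ⟨hE, rfl⟩ := hE
    dsimp only
    rw [← pow_add, ← card_union_of_disjoint]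
    · congr 2
      ext e
      simp only [mem_union, mem_filter, mem_compl, Set.mem_toFinset]
      constructor
      · intro he
        rcases mem_edge_iff_of_reach (p := p) he with h | h
        exacts [Or.inl ⟨he, h⟩, Or.inr ⟨he, h⟩]
      · rintro (h | h) <;> exact h.1
    · rw [disjoint_filter]
      intro e _ he he'
      induction e with
      | h a b =>
        exact mem_compl.1 (he' a (Sym2.mem_mk_left a b)) (he a (Sym2.mem_mk_left a b))

/-- The signed sums over connected spanning subgraphs of an induced subgraph, seen inside the
ambient graph. -/
theorem connSum_comap (f : β ↪ α) (H : SimpleGraph α) (p : β) :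
    connSum (H.comap f) = connSumOn H (f p) (univ.map f) := by
  classical
  rw [connSum, connSumOn]
  have hmem : ∀ (E : Finset (Sym2 β)) (a b : β), s(f a, f b) ∈ E.map f.sym2Map ↔ s(a, b) ∈ E := by
    intro E a b
    rw [show s(f a, f b) = f.sym2Map s(a, b) from rfl, mem_map']
  have hreach : ∀ (E : Finset (Sym2 β)), (∀ b, b ∈ reach E p) ↔
      ((univ.map f : Finset α) : Set α) ⊆ reach (E.map f.sym2Map) (f p) := by
    intro E
    constructor
    · intro h a ha
      obtain ⟨b, -, rfl⟩ := mem_map.1 (mem_coe.1 ha)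
      intro S hp hS
      exact h b (f ⁻¹' S) hp fun a c hac ha => hS _ _ ((hmem E a c).2 hac) ha
    · intro h b S hp hS
      have := h (mem_coe.2 (mem_map_of_mem f (mem_univ b))) (f '' S) ⟨p, hp, rfl⟩ (by
        rintro _ c hac ⟨a, ha, rfl⟩
        obtain ⟨e, he, hfe⟩ := mem_map.1 hac
        have hc : c ∈ Sym2.map f e := by
          rw [show Sym2.map f e = _ from hfe]; exact Sym2.mem_mk_right _ _
        obtain ⟨c', -, rfl⟩ := Sym2.mem_map.1 hc
        exact ⟨c', hS a c' ((hmem E a c').1 hac) ha, rfl⟩)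
      obtain ⟨b', hb', h'⟩ := this
      exact f.injective h' ▸ hb'
  refine sum_nbij (fun E => E.map f.sym2Map) ?_ ?_ ?_ ?_
  · intro E hE
    rw [mem_connSets] at hE
    rw [mem_filter]
    refine ⟨mem_powerset.2 fun e he => ?_, (hreach E).1 ((fromEdgeSet_connected_iff E p).1 hE.2)⟩
    obtain ⟨e, he', rfl⟩ := mem_map.1 he
    have := hE.1 e he'
    induction e with
    | h a b =>
      refine mem_edgesIn.2 ⟨this, fun x hx => ?_⟩
      rcases Sym2.mem_iff.1 (show x ∈ s(f a, f b) from hx) with rfl | rfl <;> simp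
  · exact fun _ _ _ _ h => map_injective _ h
  · intro E hE
    rw [mem_coe, mem_filter, mem_powerset] at hE
    have himg : (univ.filter fun e => f.sym2Map e ∈ E).map f.sym2Map = E := by
      ext e
      simp only [mem_map, mem_filter, mem_univ, true_and]
      constructor
      · rintro ⟨e, he, rfl⟩; exact he
      · intro he
        have h2 := (mem_edgesIn.1 (hE.1 he)).2
        induction e with
        | h a b =>
          obtain ⟨a', -, rfl⟩ := mem_map.1 (h2 a (Sym2.mem_mk_left a b))
          obtain ⟨b', -, rfl⟩ := mem_map.1 (h2 b (Sym2.mem_mk_right _ b))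
          exact ⟨s(a', b'), he, rfl⟩
    refine ⟨univ.filter fun e => f.sym2Map e ∈ E, ?_, himg⟩
    rw [mem_coe, mem_connSets]
    refine ⟨fun e he => ?_, (fromEdgeSet_connected_iff _ p).2
      ((hreach _).2 (himg.symm ▸ hE.2))⟩
    have := (mem_edgesIn.1 (hE.1 (mem_filter.1 he).2)).1
    induction e with
    | h a b => exact this
  · intro E _
    rw [card_map]

theorem sum_powerset_edgesIn (H : SimpleGraph α) (B : Finset α) [Decidable (edgesIn H B = ∅)] :
    ∑ E ∈ (edgesIn H B).powerset, (-1 : ℂ) ^ card E = if edgesIn H B = ∅ then 1 else 0 := by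
  have := congrArg (Int.cast : ℤ → ℂ) (sum_powerset_neg_one_pow_card (x := edgesIn H B))
  push_cast at this
  simpa using this

end Graph

theorem connSum_comap_equiv {α β : Type*} [Fintype α] [Fintype β] (f : β ≃ α) (H : SimpleGraph α) :
    connSum (H.comap f) = connSum H := by
  classical
  rcases isEmpty_or_nonempty β with h | ⟨⟨p⟩⟩
  · have := f.symm.isEmpty
    rw [connSum_of_isEmpty, connSum_of_isEmpty]
  · have h1 := connSum_comap f.toEmbedding H p
    have h2 := connSum_comap (Function.Embedding.refl α) H (f p)
    rw [map_univ_equiv] at h1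
    rw [map_refl] at h2
    exact h1.trans h2.symm

/-! ### Hard-core gases of polymers: Ursell coefficients as a formal logarithm -/

section Polymer

variable {X : Type*}

/-- The interaction graph of a multiset `W` of polymers with incompatibility relation `R`: one
vertex for each copy of each polymer. -/
def clusterGraph (R : X → X → Prop) (W : X →₀ ℕ) : SimpleGraph (Σ l : X, Fin (W l)) :=
  SimpleGraph.fromRel fun p q => p.1 = q.1 ∨ R p.1 q.1

/-- `W` is a set of pairwise compatible polymers, without repetitions. -/
def Indep (R : X → X → Prop) (W : X →₀ ℕ) : Prop :=
  (∀ l, W l ≤ 1) ∧ ∀ l l', W l ≠ 0 → W l' ≠ 0 → R l l' → l = l'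

variable [Fintype X] [DecidableEq X] (R : X → X → Prop)

/-- The Ursell coefficient of a multiset of polymers. -/
noncomputable def ursellCoeff (W : X →₀ ℕ) : ℂ :=
  connSum (clusterGraph R W) / ((∏ l, (W l)! : ℕ) : ℂ)

/-- The multiset of polymers carried by a set of vertices of an interaction graph. -/
noncomputable def multiplicities {W : X →₀ ℕ} (B : Finset (Σ l : X, Fin (W l))) : X →₀ ℕ :=
  Finsupp.equivFunOnFinite.symm fun l => card (univ.filter fun i : Fin (W l) => ⟨l, i⟩ ∈ B)

theorem multiplicities_apply {W : X →₀ ℕ} (B : Finset (Σ l : X, Fin (W l))) (l : X) :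
    multiplicities B l = card (univ.filter fun i : Fin (W l) => ⟨l, i⟩ ∈ B) := rfl

theorem multiplicities_add_compl {W : X →₀ ℕ} (B : Finset (Σ l : X, Fin (W l))) :
    multiplicities B + multiplicities Bᶜ = W := by
  ext l
  rw [Finsupp.add_apply, multiplicities_apply, multiplicities_apply]
  simp only [mem_compl]
  rw [card_filter_add_card_filter_not]
  simp

theorem exists_embedding {W : X →₀ ℕ} (B : Finset (Σ l : X, Fin (W l))) :
    ∃ f : (Σ l : X, Fin (multiplicities B l)) ↪ (Σ l : X, Fin (W l)),
      univ.map f = B ∧ (clusterGraph R W).comap f = clusterGraph R (multiplicities B) := by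
  let e : ∀ l, Fin (multiplicities B l) ↪o Fin (W l) := fun l =>
    (univ.filter fun i : Fin (W l) => ⟨l, i⟩ ∈ B).orderEmbOfFin rfl
  let f : (Σ l : X, Fin (multiplicities B l)) ↪ (Σ l : X, Fin (W l)) :=
    ⟨fun p => ⟨p.1, e p.1 p.2⟩, by
      rintro ⟨l, i⟩ ⟨l', i'⟩ h
      obtain rfl : l = l' := congrArg Sigma.fst h
      have h' : e l i = e l i' := by simpa using h
      rw [(e l).injective h']⟩
  refine ⟨f, ?_, ?_⟩
  · ext ⟨l, i⟩
    have hr : i ∈ Set.range (e l) ↔ (⟨l, i⟩ : Σ l : X, Fin (W l)) ∈ B := by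
      have := range_orderEmbOfFin (univ.filter fun i : Fin (W l) => ⟨l, i⟩ ∈ B) rfl
      rw [show Set.range (e l) = _ from this]; simp
    rw [← hr]
    constructor
    · intro h
      obtain ⟨⟨l', j⟩, -, hj⟩ := mem_map.1 h
      obtain rfl : l' = l := congrArg Sigma.fst hj
      exact ⟨j, eq_of_heq (Sigma.mk.inj hj).2⟩
    · rintro ⟨j, rfl⟩
      exact mem_map.2 ⟨⟨l, j⟩, mem_univ _, rfl⟩
  · ext a b
    simp only [SimpleGraph.comap_adj, clusterGraph, SimpleGraph.fromRel_adj, ne_eq,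
      f.injective.eq_iff]
    rfl

theorem edgesIn_univ_eq_empty_iff (W : X →₀ ℕ) :
    edgesIn (clusterGraph R W) univ = ∅ ↔ Indep R W := by
  have h1 : edgesIn (clusterGraph R W) univ = ∅ ↔ ∀ p q, ¬ (clusterGraph R W).Adj p q := by
    constructor
    · intro h p q hpq
      have : s(p, q) ∈ edgesIn (clusterGraph R W) univ :=
        mem_edgesIn.2 ⟨hpq, fun _ _ => mem_univ _⟩
      rw [h] at this
      exact notMem_empty _ this
    · intro h
      refine eq_empty_of_forall_notMem fun e he => ?_
      induction e with
      | h a b => exact h a b (mem_edgesIn.1 he).1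
  rw [h1]
  simp only [clusterGraph, SimpleGraph.fromRel_adj, not_and, not_or]
  constructor
  · intro h
    refine ⟨fun l => ?_, fun l l' hl hl' hR => ?_⟩
    · by_contra hl
      push Not at hl
      exact (h ⟨l, ⟨0, by omega⟩⟩ ⟨l, ⟨1, hl⟩⟩ (by simp)).1.1 rfl
    · by_contra hne
      exact (h ⟨l, ⟨0, by omega⟩⟩ ⟨l', ⟨0, by omega⟩⟩
        (fun h => hne (congrArg Sigma.fst h))).1.2 hR
  · rintro ⟨h1, h2⟩
    have key : ∀ p q : Σ l : X, Fin (W l), p ≠ q → ¬ p.1 = q.1 ∧ ¬ R p.1 q.1 := by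
      rintro ⟨l, i⟩ ⟨l', i'⟩ hne
      have hll : l ≠ l' := by
        rintro rfl
        apply hne
        have := h1 l
        congr 1
        ext
        omega
      refine ⟨hll, fun hR => hll (h2 l l' ?_ ?_ hR)⟩
      · have := i.2; omega
      · have := i'.2; omega
    exact fun p q hne => ⟨key p q hne, key q p hne.symm⟩

theorem edgesIn_eq_empty_iff {W : X →₀ ℕ} (B : Finset (Σ l : X, Fin (W l))) :
    edgesIn (clusterGraph R W) B = ∅ ↔ Indep R (multiplicities B) := by
  obtain ⟨f, hf, hg⟩ := exists_embedding R B
  rw [← edgesIn_univ_eq_empty_iff, ← hg]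
  constructor
  · intro h
    refine eq_empty_of_forall_notMem fun e he => ?_
    induction e with
    | h a b =>
      have : s(f a, f b) ∈ edgesIn (clusterGraph R W) B := by
        refine mem_edgesIn.2 ⟨(mem_edgesIn.1 he).1, fun x hx => ?_⟩
        rw [← hf]
        rcases Sym2.mem_iff.1 hx with rfl | rfl <;> simp
      rw [h] at this
      exact notMem_empty _ this
  · intro h
    refine eq_empty_of_forall_notMem fun e he => ?_
    rw [mem_edgesIn] at he
    induction e with
    | h a b =>
      obtain ⟨a', -, rfl⟩ := mem_map.1 (hf ▸ he.2 a (Sym2.mem_mk_left a b))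
      obtain ⟨b', -, rfl⟩ := mem_map.1 (hf ▸ he.2 b (Sym2.mem_mk_right _ b))
      have : s(a', b') ∈ edgesIn ((clusterGraph R W).comap f) univ :=
        mem_edgesIn.2 ⟨he.1, fun _ _ => mem_univ _⟩
      rw [h] at this
      exact notMem_empty _ this

theorem connSumOn_clusterGraph {W : X →₀ ℕ} {B : Finset (Σ l : X, Fin (W l))}
    {p : Σ l : X, Fin (W l)} (hp : p ∈ B) :
    connSumOn (clusterGraph R W) p B = connSum (clusterGraph R (multiplicities B)) := by
  obtain ⟨f, hf, hg⟩ := exists_embedding R B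
  rw [← hf] at hp
  obtain ⟨p', -, rfl⟩ := mem_map.1 hp
  rw [← hg, connSum_comap f _ p', hf]

theorem card_multiplicities_eq {W U V : X →₀ ℕ} (h : U + V = W) :
    card (univ.filter fun B : Finset (Σ l : X, Fin (W l)) => multiplicities B = U) *
      ((∏ l, (U l)!) * ∏ l, (V l)!) = ∏ l, (W l)! := by
  have hcard : card (univ.filter fun B : Finset (Σ l : X, Fin (W l)) => multiplicities B = U) =
      ∏ l, (W l).choose (U l) := by
    have : ∏ l, (W l).choose (U l) =
        card (Fintype.piFinset fun l => powersetCard (U l) (univ : Finset (Fin (W l)))) := by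
      rw [Fintype.card_piFinset]
      simp
    rw [this]
    refine card_nbij' (fun B l => univ.filter fun i : Fin (W l) => ⟨l, i⟩ ∈ B)
      (fun b => univ.sigma b) ?_ ?_ ?_ ?_
    · rintro B hB
      obtain rfl := (mem_filter.1 hB).2
      simp [multiplicities_apply]
    · intro b hb
      simp only [mem_coe, Fintype.mem_piFinset, mem_powersetCard, subset_univ, true_and] at hb
      simp only [coe_filter, mem_univ, true_and, Set.mem_ofPred_eq]
      ext l
      rw [multiplicities_apply]
      convert hb l using 2
      ext i
      simp
    · intro B _
      ext ⟨l, i⟩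
      simp
    · intro b _
      ext l i
      simp
  rw [hcard, ← prod_mul_distrib, ← prod_mul_distrib]
  refine prod_congr rfl fun l _ => ?_
  have hl : W l = U l + V l := by rw [← h]; rfl
  have := Nat.choose_mul_factorial_mul_factorial (Nat.le_add_right (U l) (V l))
  rwa [Nat.add_sub_cancel_left, mul_assoc, ← hl] at this

open Classical in
/-- The logarithmic derivative of the partition function of the polymer gas, coefficient by
coefficient. -/
theorem indep_coeff_eq (W : X →₀ ℕ) (x : X) :
    (W x : ℂ) * (if Indep R W then 1 else 0) =
      ∑ p ∈ antidiagonal W, ((p.1 x : ℂ) * ursellCoeff R p.1) * (if Indep R p.2 then 1 else 0) := by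
  have hfact : ∀ V : X →₀ ℕ, Indep R V → ∏ l, (V l)! = 1 := by
    intro V hV
    refine prod_eq_one fun l _ => ?_
    have := hV.1 l
    interval_cases V l <;> rfl
  have h1 : ∀ i : Fin (W x), (if Indep R W then (1 : ℂ) else 0) =
      ∑ B : Finset (Σ l : X, Fin (W l)), if ⟨x, i⟩ ∈ B then
        connSum (clusterGraph R (multiplicities B)) *
          (if Indep R (multiplicities Bᶜ) then 1 else 0) else 0 := by
    intro i
    have := sum_powerset_edges_eq (clusterGraph R W) ⟨x, i⟩
    rw [sum_powerset_edgesIn] at this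
    simp only [edgesIn_univ_eq_empty_iff] at this
    rw [this, sum_filter]
    refine sum_congr rfl fun B _ => ?_
    split_ifs with hB hI <;>
    simp_all [connSumOn_clusterGraph R, sum_powerset_edgesIn, edgesIn_eq_empty_iff]
  have h2 : (W x : ℂ) * (if Indep R W then 1 else 0) =
      ∑ B : Finset (Σ l : X, Fin (W l)), (multiplicities B x : ℂ) *
        (connSum (clusterGraph R (multiplicities B)) *
          (if Indep R (multiplicities Bᶜ) then 1 else 0)) := by
    have : ∑ i : Fin (W x), (if Indep R W then (1 : ℂ) else 0) =
      (W x : ℂ) * (if Indep R W then 1 else 0) := by simp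
    rw [← this, sum_congr rfl fun i _ => h1 i, sum_comm]
    refine sum_congr rfl fun B _ => ?_
    rw [multiplicities_apply, ← sum_filter, sum_const, nsmul_eq_mul]
  have h3 : (W x : ℂ) * (if Indep R W then 1 else 0) = ((∏ l, (W l)! : ℕ) : ℂ) *
      ∑ p ∈ antidiagonal W, ((p.1 x : ℂ) * ursellCoeff R p.1) *
        (if Indep R p.2 then 1 else 0) := by
    have hmaps : ∀ B ∈ (univ : Finset (Finset (Σ l : X, Fin (W l)))),
        (multiplicities B, multiplicities Bᶜ) ∈ antidiagonal W := fun B _ =>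
      HasAntidiagonal.mem_antidiagonal.2 (multiplicities_add_compl B)
    rw [h2, ← sum_fiberwise_of_maps_to hmaps, mul_sum]
    refine sum_congr rfl ?_
    rintro ⟨U, V⟩ hUV
    rw [HasAntidiagonal.mem_antidiagonal] at hUV
    dsimp only at hUV ⊢
    have hfilter : (univ.filter fun B : Finset (Σ l : X, Fin (W l)) =>
        (multiplicities B, multiplicities Bᶜ) = (U, V)) =
        univ.filter fun B => multiplicities B = U := by
      ext B
      simp only [mem_filter, mem_univ, true_and, Prod.mk.injEq, and_iff_left_iff_imp]
      rintro rfl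
      exact add_left_cancel ((multiplicities_add_compl B).trans hUV.symm)
    have hsum : ∑ B : Finset (Σ l : X, Fin (W l)) with
        (multiplicities B, multiplicities Bᶜ) = (U, V),
        (multiplicities B x : ℂ) * (connSum (clusterGraph R (multiplicities B)) *
          (if Indep R (multiplicities Bᶜ) then 1 else 0)) =
        ∑ B : Finset (Σ l : X, Fin (W l)) with (multiplicities B, multiplicities Bᶜ) = (U, V),
        (U x : ℂ) * (connSum (clusterGraph R U) * (if Indep R V then 1 else 0)) := by
      refine sum_congr rfl fun B hB => ?_
      have h' := (mem_filter.1 hB).2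
      rw [Prod.mk.injEq] at h'
      rw [h'.1, h'.2]
    rw [hsum, sum_const, nsmul_eq_mul, hfilter]
    by_cases hV : Indep R V
    · have hc := card_multiplicities_eq hUV
      rw [hfact V hV, mul_one] at hc
      rw [← hc, ursellCoeff]
      have hne : ((∏ l, (U l)! : ℕ) : ℂ) ≠ 0 := by
        exact_mod_cast prod_ne_zero_iff.2 fun l _ => (U l).factorial_ne_zero
      rw [if_pos hV, Nat.cast_mul]
      field_simp
    · simp [hV]
  by_cases hW : Indep R W
  · rw [h3, hfact W hW]; simp
  · rw [if_neg hW, mul_zero] at h3 ⊢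
    have hne : ((∏ l, (W l)! : ℕ) : ℂ) ≠ 0 := by
      exact_mod_cast prod_ne_zero_iff.2 fun l _ => (W l).factorial_ne_zero
    exact ((mul_eq_zero.1 h3.symm).resolve_left hne).symm

end Polymer

section FormalLog

variable {X : Type*}

/-- The derivation `X_y ∂/∂X_y` on formal power series. -/
noncomputable def euler (y : X) (f : MvPowerSeries X ℂ) : MvPowerSeries X ℂ :=
  fun W => (W y : ℂ) * MvPowerSeries.coeff W f

theorem coeff_euler (y : X) (f : MvPowerSeries X ℂ) (W : X →₀ ℕ) :
    MvPowerSeries.coeff W (euler y f) = (W y : ℂ) * MvPowerSeries.coeff W f := rfl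

theorem euler_mul (y : X) (f g : MvPowerSeries X ℂ) :
    euler y (f * g) = euler y f * g + f * euler y g := by
  classical
  ext W
  rw [coeff_euler, map_add, MvPowerSeries.coeff_mul, MvPowerSeries.coeff_mul,
    MvPowerSeries.coeff_mul, mul_sum, ← sum_add_distrib]
  refine sum_congr rfl fun p hp => ?_
  rw [coeff_euler, coeff_euler, ← HasAntidiagonal.mem_antidiagonal.1 hp, Finsupp.add_apply]
  push_cast
  ring

variable (R : X → X → Prop)

open Classical in
/-- The partition function of the gas of polymers in `A`, as a formal power series. -/
noncomputable def partitionSeries (A : Set X) : MvPowerSeries X ℂ :=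
  fun W => if Indep R W ∧ ∀ l, W l ≠ 0 → l ∈ A then 1 else 0

theorem coeff_zero_partitionSeries (A : Set X) :
    MvPowerSeries.coeff 0 (partitionSeries R A) = 1 := by
  simp only [partitionSeries, MvPowerSeries.coeff_apply]
  rw [if_pos (by simp [Indep])]

theorem partitionSeries_ne_zero (A : Set X) : partitionSeries R A ≠ 0 := by
  intro h
  have := coeff_zero_partitionSeries R A
  simp [h] at this

variable [Fintype X]

open Classical in
/-- The cluster series of the gas of polymers in `A`. -/
noncomputable def clusterSeries (A : Set X) : MvPowerSeries X ℂ :=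
  fun W => if ∀ l, W l ≠ 0 → l ∈ A then ursellCoeff R W else 0

/-- The derivative of the cluster series with respect to the activity of `x`: the clusters
rooted at `x`. -/
noncomputable def rootedSeries (x : X) : MvPowerSeries X ℂ :=
  fun W => ((W x : ℂ) + 1) * ursellCoeff R (W + Finsupp.single x 1)

open Classical in
/-- The part of the cluster series that comes from clusters with a polymer incompatible with `x`. -/
noncomputable def touchingSeries (x : X) : MvPowerSeries X ℂ :=
  fun W => if ∃ l, W l ≠ 0 ∧ R x l then ursellCoeff R W else 0

theorem X_mul_rootedSeries (x : X) :
    MvPowerSeries.X x * rootedSeries R x = euler x (clusterSeries R Set.univ) := by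
  classical
  ext W
  rw [coeff_euler, MvPowerSeries.X, MvPowerSeries.coeff_monomial_mul]
  have hc : MvPowerSeries.coeff W (clusterSeries R Set.univ) = ursellCoeff R W := by
    simp [clusterSeries, MvPowerSeries.coeff_apply]
  rw [hc]
  split_ifs with h
  · have hW : W - Finsupp.single x 1 + Finsupp.single x 1 = W := tsub_add_cancel_of_le h
    have hx : (W x : ℂ) = ((W - Finsupp.single x 1 : X →₀ ℕ) x : ℂ) + 1 := by
      conv_lhs => rw [← hW]
      simp
    rw [MvPowerSeries.coeff_apply, rootedSeries, hW, hx, one_mul]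
  · have : W x = 0 := by
      by_contra h0
      exact h (Finsupp.single_le_iff.2 (by omega))
    simp [this]

variable [DecidableEq X]

theorem euler_partitionSeries (A : Set X) (y : X) :
    euler y (partitionSeries R A) = euler y (clusterSeries R A) * partitionSeries R A := by
  classical
  ext W
  rw [MvPowerSeries.coeff_mul]
  by_cases hA : ∀ l, W l ≠ 0 → l ∈ A
  · have h1 : MvPowerSeries.coeff W (euler y (partitionSeries R A)) =
        (W y : ℂ) * (if Indep R W then 1 else 0) := by
      rw [coeff_euler]
      simp only [partitionSeries, MvPowerSeries.coeff_apply, eq_iff_iff.2 (and_iff_left hA)]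
    rw [h1, indep_coeff_eq]
    refine sum_congr rfl fun p hp => ?_
    rw [HasAntidiagonal.mem_antidiagonal] at hp
    have h2 : ∀ l, p.1 l ≠ 0 → l ∈ A := fun l hl => hA l (by
      rw [← hp, Finsupp.add_apply]; omega)
    have h3 : ∀ l, p.2 l ≠ 0 → l ∈ A := fun l hl => hA l (by
      rw [← hp, Finsupp.add_apply]; omega)
    rw [coeff_euler]
    simp only [partitionSeries, clusterSeries, MvPowerSeries.coeff_apply]
    rw [if_pos h2]
    congr 1
    simp only [eq_iff_iff.2 (and_iff_left h3)]
  · have h1 : MvPowerSeries.coeff W (euler y (partitionSeries R A)) = 0 := by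
      rw [coeff_euler]
      simp only [partitionSeries, MvPowerSeries.coeff_apply]
      rw [if_neg (fun h => hA h.2), mul_zero]
    rw [h1]
    refine (sum_eq_zero fun p hp => ?_).symm
    rw [HasAntidiagonal.mem_antidiagonal] at hp
    rw [coeff_euler]
    simp only [partitionSeries, clusterSeries, MvPowerSeries.coeff_apply]
    by_cases h2 : ∀ l, p.1 l ≠ 0 → l ∈ A
    · by_cases h3 : ∀ l, p.2 l ≠ 0 → l ∈ A
      · refine absurd (fun l hl => ?_) hA
        rw [← hp, Finsupp.add_apply] at hl
        by_cases h4 : p.1 l = 0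
        · exact h3 l (by omega)
        · exact h2 l h4
      · rw [if_neg (c := Indep R p.2 ∧ _) (fun h => h3 h.2), mul_zero]
    · rw [if_neg h2, mul_zero, zero_mul]

variable {R}

theorem X_mul_partitionSeries (hrefl : ∀ x, R x x) (hsymm : ∀ x y, R x y → R y x) (x : X) :
    MvPowerSeries.X x * partitionSeries R {y | ¬ R x y} =
      euler x (partitionSeries R Set.univ) := by
  classical
  ext W
  rw [coeff_euler, MvPowerSeries.X, MvPowerSeries.coeff_monomial_mul]
  simp only [partitionSeries, MvPowerSeries.coeff_apply, Set.mem_univ, implies_true, and_true,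
    Set.mem_ofPred_eq, one_mul]
  split_ifs with h hI hI' hI'
  · have h1 : W x = 1 := le_antisymm (hI'.1 x) (by simpa using h x)
    rw [h1]; simp
  · refine absurd ?_ hI'
    obtain ⟨⟨h1, h2⟩, h3⟩ := hI
    have hW : W - Finsupp.single x 1 + Finsupp.single x 1 = W := tsub_add_cancel_of_le h
    generalize W - Finsupp.single x 1 = V at *
    subst hW
    have hVx : V x = 0 := by
      by_contra h0
      exact h3 x h0 (hrefl x)
    refine ⟨fun l => ?_, fun l l' hl hl' hR => ?_⟩
    · have := h1 l
      by_cases hlx : x = l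
      · subst hlx; simp [hVx]
      · simpa [Finsupp.single_apply, hlx] using this
    · by_cases hlx : x = l
      · by_cases hlx' : x = l'
        · exact hlx.symm.trans hlx'
        · refine absurd (hlx ▸ hR) (h3 l' ?_)
          simpa [Finsupp.single_apply, hlx'] using hl'
      · by_cases hlx' : x = l'
        · refine absurd (hsymm _ _ (hlx' ▸ hR)) (h3 l ?_)
          simpa [Finsupp.single_apply, hlx] using hl
        · refine h2 l l' ?_ ?_ hR
          · simpa [Finsupp.single_apply, hlx] using hl
          · simpa [Finsupp.single_apply, hlx'] using hl'
  · refine absurd ?_ hI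
    have hW : W - Finsupp.single x 1 + Finsupp.single x 1 = W := tsub_add_cancel_of_le h
    generalize W - Finsupp.single x 1 = V at *
    subst hW
    obtain ⟨h1, h2⟩ := hI'
    have hVx : V x = 0 := by
      have := h1 x
      simp at this
      omega
    have hne : ∀ l, V l ≠ 0 → (V + Finsupp.single x 1 : X →₀ ℕ) l ≠ 0 := by
      intro l hl
      rw [Finsupp.add_apply]; omega
    refine ⟨⟨fun l => le_trans ?_ (h1 l), fun l l' hl hl' => h2 l l' (hne l hl) (hne l' hl')⟩, ?_⟩
    · rw [Finsupp.add_apply]; omega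
    · intro l hl hR
      have := h2 x l (by simp) (hne l hl) hR
      exact hl (this ▸ hVx)
  · simp
  · have : W x = 0 := by
      by_contra h0
      exact h (Finsupp.single_le_iff.2 (by omega))
    simp [this]
  · simp

theorem rootedSeries_mul_partitionSeries (hrefl : ∀ x, R x x) (hsymm : ∀ x y, R x y → R y x)
    (x : X) : rootedSeries R x * partitionSeries R Set.univ = partitionSeries R {y | ¬ R x y} := by
  have h : MvPowerSeries.X x * (rootedSeries R x * partitionSeries R Set.univ) =
      MvPowerSeries.X x * partitionSeries R {y | ¬ R x y} := by
    rw [X_mul_partitionSeries hrefl hsymm, ← mul_assoc, X_mul_rootedSeries, euler_partitionSeries]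
  refine mul_left_cancel₀ (fun h0 => ?_) h
  have := congrArg (MvPowerSeries.coeff (Finsupp.single x 1)) h0
  rw [MvPowerSeries.coeff_X] at this
  simp at this

/-- The rooted clusters are the exponential of minus the clusters touching the root. This is the
source of the Kotecký–Preiss recursion. -/
theorem euler_rootedSeries (hrefl : ∀ x, R x x) (hsymm : ∀ x y, R x y → R y x) (x y : X) :
    euler y (rootedSeries R x) = - (euler y (touchingSeries R x) * rootedSeries R x) := by
  have h1 := congrArg (euler y) (rootedSeries_mul_partitionSeries hrefl hsymm x)
  rw [euler_mul, euler_partitionSeries R {y | ¬ R x y}, euler_partitionSeries,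
    ← rootedSeries_mul_partitionSeries hrefl hsymm x] at h1
  have h2 : euler y (clusterSeries R Set.univ) =
      euler y (clusterSeries R {y | ¬ R x y}) + euler y (touchingSeries R x) := by
    ext W
    rw [map_add, coeff_euler, coeff_euler, coeff_euler, ← mul_add]
    congr 1
    simp only [clusterSeries, touchingSeries, MvPowerSeries.coeff_apply, Set.mem_univ,
      implies_true, if_true, Set.mem_ofPred_eq]
    by_cases h : ∃ l, W l ≠ 0 ∧ R x l
    · rw [if_neg, if_pos h, zero_add]
      obtain ⟨l, hl, hR⟩ := h
      exact fun h' => h' l hl hR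
    · rw [if_pos, if_neg h, add_zero]
      exact fun l hl hR => h ⟨l, hl, hR⟩
  refine mul_right_cancel₀ (partitionSeries_ne_zero R Set.univ) ?_
  rw [h2] at h1
  linear_combination h1

end FormalLog

/-! ### The Kotecký–Preiss bound on rooted clusters -/

section KoteckyPreiss

variable {X : Type*} [Fintype X]

/-- The monomial `∏ ρ_l ^ W_l`. -/
def monom {M : Type*} [CommMonoid M] (ρ : X → M) (W : X →₀ ℕ) : M := ∏ l, ρ l ^ W l

theorem monom_add {M : Type*} [CommMonoid M] (ρ : X → M) (U V : X →₀ ℕ) :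
    monom ρ (U + V) = monom ρ U * monom ρ V := by
  simp [monom, pow_add, prod_mul_distrib]

theorem monom_single {M : Type*} [CommMonoid M] (ρ : X → M) (x : X) :
    monom ρ (Finsupp.single x 1) = ρ x := by
  classical
  rw [monom, prod_eq_single x] <;> simp +contextual [eq_comm]

theorem monom_zero {M : Type*} [CommMonoid M] (ρ : X → M) : monom ρ (0 : X →₀ ℕ) = 1 := by
  simp [monom]

theorem monom_nonneg {ρ : X → ℝ} (hρ : ∀ x, 0 ≤ ρ x) (W : X →₀ ℕ) : 0 ≤ monom ρ W :=
  prod_nonneg fun l _ => pow_nonneg (hρ l) _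

variable (X) in
/-- The multisets of at most `M` polymers. -/
noncomputable def degreeLE (M : ℕ) : Finset (X →₀ ℕ) := (Finsupp.finite_of_degree_le M).toFinset

theorem mem_degreeLE {M : ℕ} {W : X →₀ ℕ} : W ∈ degreeLE X M ↔ W.degree ≤ M := by
  simp [degreeLE]

variable {R : X → X → Prop}

theorem coeff_zero_touchingSeries (x : X) :
    MvPowerSeries.coeff 0 (touchingSeries R x) = 0 := by
  simp [touchingSeries, MvPowerSeries.coeff_apply]

theorem sum_degreeLE_succ_eq {ρ : X → ℝ} (M : ℕ) (y : X) :
    ∑ W ∈ degreeLE X (M + 1), (W y : ℝ) * ‖ursellCoeff R W‖ * monom ρ W =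
      ρ y * ∑ W ∈ degreeLE X M, ‖MvPowerSeries.coeff W (rootedSeries R y)‖ * monom ρ W := by
  rw [mul_sum]
  have h1 : ∑ W ∈ degreeLE X (M + 1), (W y : ℝ) * ‖ursellCoeff R W‖ * monom ρ W =
      ∑ W ∈ (degreeLE X M).map (addRightEmbedding (Finsupp.single y 1)),
        (W y : ℝ) * ‖ursellCoeff R W‖ * monom ρ W := by
    symm
    refine sum_subset ?_ ?_
    · intro W hW
      obtain ⟨V, hV, rfl⟩ := mem_map.1 hW
      rw [mem_degreeLE] at hV ⊢
      simp only [addRightEmbedding_apply, map_add, Finsupp.degree_single]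
      omega
    · intro W hW hW'
      by_cases h : W y = 0
      · simp [h]
      · refine absurd (mem_map.2 ⟨W - Finsupp.single y 1, ?_, ?_⟩) hW'
        · rw [mem_degreeLE] at hW ⊢
          have : W - Finsupp.single y 1 + Finsupp.single y 1 = W :=
            tsub_add_cancel_of_le (Finsupp.single_le_iff.2 (by omega))
          rw [← this, map_add, Finsupp.degree_single] at hW
          omega
        · exact tsub_add_cancel_of_le (Finsupp.single_le_iff.2 (by omega))
  rw [h1, sum_map]
  refine sum_congr rfl fun W _ => ?_
  have h2 : MvPowerSeries.coeff W (rootedSeries R y) =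
      ((W y : ℂ) + 1) * ursellCoeff R (W + Finsupp.single y 1) := rfl
  have h3 : ‖(W y : ℂ) + 1‖ = (W y : ℝ) + 1 := by
    rw [← Nat.cast_succ, Complex.norm_natCast, Nat.cast_succ]
  rw [h2, norm_mul, h3, addRightEmbedding_apply, monom_add, monom_single]
  simp
  ring

variable [DecidableEq X]

theorem sum_sum_antidiagonal_le (M : ℕ) {f g : (X →₀ ℕ) → ℝ} (hf : ∀ W, 0 ≤ f W)
    (hg : ∀ W, 0 ≤ g W) :
    ∑ W ∈ degreeLE X M, ∑ p ∈ antidiagonal W, f p.1 * g p.2 ≤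
      (∑ W ∈ degreeLE X M, f W) * ∑ W ∈ degreeLE X M, g W := by
  rw [sum_mul_sum, ← sum_product', sum_sigma']
  have himg : ∑ x ∈ (degreeLE X M).sigma (fun W => antidiagonal W), f x.2.1 * g x.2.2 =
      ∑ p ∈ ((degreeLE X M).sigma (fun W => antidiagonal W)).image (fun x => x.2),
        f p.1 * g p.2 := by
    rw [sum_image]
    rintro ⟨W, p⟩ h ⟨W', p'⟩ h' (rfl : p = p')
    simp only [coe_sigma, Set.mem_sigma_iff, mem_coe, HasAntidiagonal.mem_antidiagonal] at h h'
    obtain rfl : W = W' := h.2.symm.trans h'.2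
    rfl
  rw [himg]
  refine sum_le_sum_of_subset_of_nonneg ?_ fun p _ _ => mul_nonneg (hf _) (hg _)
  intro p hp
  obtain ⟨⟨W, p⟩, h, rfl⟩ := mem_image.1 hp
  simp only [mem_sigma, HasAntidiagonal.mem_antidiagonal, mem_degreeLE] at h
  rw [← h.2, map_add] at h
  simp only [mem_product, mem_degreeLE]
  omega

theorem degree_mul_norm_rootedSeries_le (hrefl : ∀ x, R x x) (hsymm : ∀ x y, R x y → R y x)
    (x : X) (W : X →₀ ℕ) :
    (W.degree : ℝ) * ‖MvPowerSeries.coeff W (rootedSeries R x)‖ ≤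
      ∑ p ∈ antidiagonal W, (p.1.degree : ℝ) * ‖MvPowerSeries.coeff p.1 (touchingSeries R x)‖ *
        ‖MvPowerSeries.coeff p.2 (rootedSeries R x)‖ := by
  have h : (W.degree : ℂ) * MvPowerSeries.coeff W (rootedSeries R x) =
      - ∑ p ∈ antidiagonal W, (p.1.degree : ℂ) * MvPowerSeries.coeff p.1 (touchingSeries R x) *
        MvPowerSeries.coeff p.2 (rootedSeries R x) := by
    have h1 : ∀ y, (W y : ℂ) * MvPowerSeries.coeff W (rootedSeries R x) =
        - ∑ p ∈ antidiagonal W, (p.1 y : ℂ) * MvPowerSeries.coeff p.1 (touchingSeries R x) *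
          MvPowerSeries.coeff p.2 (rootedSeries R x) := by
      intro y
      rw [← coeff_euler, euler_rootedSeries hrefl hsymm, map_neg, MvPowerSeries.coeff_mul]
      rfl
    simp only [Finsupp.degree_eq_sum, Nat.cast_sum, sum_mul]
    rw [sum_congr rfl fun y _ => h1 y, sum_neg_distrib, sum_comm]
  have h2 := congrArg norm h
  rw [norm_mul, norm_neg, Complex.norm_natCast] at h2
  rw [h2]
  refine (norm_sum_le _ _).trans (le_of_eq (sum_congr rfl fun p _ => ?_))
  rw [norm_mul, norm_mul, Complex.norm_natCast]

theorem coeff_zero_rootedSeries (hrefl : ∀ x, R x x) (hsymm : ∀ x y, R x y → R y x) (x : X) :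
    MvPowerSeries.coeff 0 (rootedSeries R x) = 1 := by
  have h := congrArg (MvPowerSeries.coeff 0) (rootedSeries_mul_partitionSeries hrefl hsymm x)
  rwa [MvPowerSeries.coeff_mul, Finsupp.antidiagonal_zero, sum_singleton,
    coeff_zero_partitionSeries,
    coeff_zero_partitionSeries, mul_one] at h

/-- Integrating the differential inequality `p' ≤ c' p` that `euler_rootedSeries` gives for the
truncated majorants `p` of the rooted series and `c` of the series touching the root. -/
theorem sum_rooted_le_exp (hrefl : ∀ x, R x x) (hsymm : ∀ x y, R x y → R y x)
    {ρ : X → ℝ} (hρ : ∀ x, 0 ≤ ρ x) (M : ℕ) (x : X) :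
    ∑ W ∈ degreeLE X M, ‖MvPowerSeries.coeff W (rootedSeries R x)‖ * monom ρ W ≤
      Real.exp (∑ W ∈ degreeLE X M,
        ‖MvPowerSeries.coeff W (touchingSeries R x)‖ * monom ρ W) := by
  set r : (X →₀ ℕ) → ℝ := fun W => ‖MvPowerSeries.coeff W (rootedSeries R x)‖ * monom ρ W with hr
  set s : (X →₀ ℕ) → ℝ := fun W => ‖MvPowerSeries.coeff W (touchingSeries R x)‖ * monom ρ W with hs
  have hr0 : ∀ W, 0 ≤ r W := fun W => mul_nonneg (norm_nonneg _) (monom_nonneg hρ W)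
  have hs0 : ∀ W, 0 ≤ s W := fun W => mul_nonneg (norm_nonneg _) (monom_nonneg hρ W)
  have hderiv : ∀ (f : (X →₀ ℕ) → ℝ) (t : ℝ), HasDerivAt
      (fun t : ℝ => ∑ W ∈ degreeLE X M, f W * t ^ W.degree)
      (∑ W ∈ degreeLE X M, f W * (W.degree * t ^ (W.degree - 1))) t := by
    intro f t
    refine HasDerivAt.fun_sum fun W _ => ?_
    exact (hasDerivAt_pow _ t).const_mul _
  have hmain : ∀ t : ℝ, 0 < t → ∑ W ∈ degreeLE X M, r W * (W.degree * t ^ (W.degree - 1)) ≤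
      (∑ W ∈ degreeLE X M, s W * (W.degree * t ^ (W.degree - 1))) *
        ∑ W ∈ degreeLE X M, r W * t ^ W.degree := by
    intro t ht
    refine le_trans ?_ (sum_sum_antidiagonal_le M
      (f := fun W => s W * (W.degree * t ^ (W.degree - 1))) (g := fun W => r W * t ^ W.degree)
      (fun W => mul_nonneg (hs0 W) (by positivity)) fun W => mul_nonneg (hr0 W) (by positivity))
    refine sum_le_sum fun W _ => ?_
    have h1 := mul_le_mul_of_nonneg_right (degree_mul_norm_rootedSeries_le hrefl hsymm x W)
      (mul_nonneg (monom_nonneg hρ W) (pow_nonneg ht.le (W.degree - 1)))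
    refine le_trans (le_of_eq ?_) (h1.trans (le_of_eq ?_))
    · simp only [hr]; ring
    · rw [sum_mul]
      refine sum_congr rfl fun p hp => ?_
      rw [HasAntidiagonal.mem_antidiagonal] at hp
      subst hp
      simp only [hr, hs, monom_add, map_add]
      by_cases h0 : p.1.degree = 0
      · simp [h0]
      · rw [show p.1.degree + p.2.degree - 1 = (p.1.degree - 1) + p.2.degree by omega, pow_add]
        ring
  set p : ℝ → ℝ := fun t => ∑ W ∈ degreeLE X M, r W * t ^ W.degree with hp
  set c : ℝ → ℝ := fun t => ∑ W ∈ degreeLE X M, s W * t ^ W.degree with hc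
  have hd : ∀ t, HasDerivAt (fun t => p t * Real.exp (-c t))
      ((∑ W ∈ degreeLE X M, r W * (W.degree * t ^ (W.degree - 1))) * Real.exp (-c t) +
        p t * (Real.exp (-c t) *
          -(∑ W ∈ degreeLE X M, s W * (W.degree * t ^ (W.degree - 1))))) t := fun t =>
    (hderiv r t).mul ((hderiv s t).neg.exp)
  have hanti : AntitoneOn (fun t => p t * Real.exp (-c t)) (Set.Icc 0 1) := by
    refine antitoneOn_of_deriv_nonpos (convex_Icc 0 1)
      (fun t _ => (hd t).continuousAt.continuousWithinAt)
      (fun t _ => (hd t).differentiableAt.differentiableWithinAt) fun t ht => ?_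
    rw [interior_Icc] at ht
    rw [(hd t).deriv]
    have := mul_le_mul_of_nonneg_right (hmain t ht.1) (Real.exp_pos (-c t)).le
    simp only [hp] at this ⊢
    linarith
  have h01 := hanti (Set.left_mem_Icc.2 zero_le_one) (Set.right_mem_Icc.2 zero_le_one) zero_le_one
  have hz : ∀ f : (X →₀ ℕ) → ℝ, ∑ W ∈ degreeLE X M, f W * (0 : ℝ) ^ W.degree = f 0 := by
    intro f
    rw [sum_eq_single 0]
    · simp
    · intro W _ hW
      rw [zero_pow, mul_zero]
      exact fun h => hW ((Finsupp.degree_eq_zero_iff W).1 h)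
    · intro h
      exact absurd (mem_degreeLE.2 (by simp)) h
  simp only [hp, hc, hz, one_pow, mul_one] at h01
  have h2 : r 0 * Real.exp (- s 0) = 1 := by
    simp [hr, hs, coeff_zero_rootedSeries hrefl hsymm, coeff_zero_touchingSeries, monom_zero]
  rw [h2, Real.exp_neg, ← div_eq_mul_inv, div_le_one (Real.exp_pos _)] at h01
  exact h01

open Classical in
/-- The Kotecký–Preiss criterion bounds the rooted clusters. -/
theorem sum_rooted_le (hrefl : ∀ x, R x x) (hsymm : ∀ x y, R x y → R y x)
    {ρ a : X → ℝ} (hρ : ∀ x, 0 ≤ ρ x)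
    (hKP : ∀ x, ∑ y with R x y, ρ y * Real.exp (a y) ≤ a x) (M : ℕ) (x : X) :
    ∑ W ∈ degreeLE X M, ‖MvPowerSeries.coeff W (rootedSeries R x)‖ * monom ρ W ≤
      Real.exp (a x) := by
  induction M generalizing x with
  | zero =>
    refine (sum_rooted_le_exp hrefl hsymm hρ 0 x).trans (Real.exp_le_exp.2 ?_)
    have : ∑ W ∈ degreeLE X 0, ‖MvPowerSeries.coeff W (touchingSeries R x)‖ * monom ρ W = 0 := by
      refine sum_eq_zero fun W hW => ?_
      rw [mem_degreeLE, Nat.le_zero, Finsupp.degree_eq_zero_iff] at hW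
      rw [hW, coeff_zero_touchingSeries, norm_zero, zero_mul]
    rw [this]
    exact (sum_nonneg fun y _ => mul_nonneg (hρ y) (Real.exp_pos _).le).trans (hKP x)
  | succ M ih =>
    refine (sum_rooted_le_exp hrefl hsymm hρ (M + 1) x).trans (Real.exp_le_exp.2 ?_)
    refine le_trans ?_ (hKP x)
    have h1 : ∀ W : X →₀ ℕ, ‖MvPowerSeries.coeff W (touchingSeries R x)‖ * monom ρ W ≤
        ∑ y with R x y, (W y : ℝ) * ‖ursellCoeff R W‖ * monom ρ W := by
      intro W
      have hnn : ∀ y, 0 ≤ (W y : ℝ) * ‖ursellCoeff R W‖ * monom ρ W := fun y =>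
        mul_nonneg (by positivity) (monom_nonneg hρ W)
      by_cases h : ∃ l, W l ≠ 0 ∧ R x l
      · have h2 : MvPowerSeries.coeff W (touchingSeries R x) = ursellCoeff R W := by
          rw [MvPowerSeries.coeff_apply, touchingSeries, if_pos h]
        obtain ⟨l, hl, hR⟩ := h
        rw [h2]
        refine le_trans ?_ (single_le_sum (fun y _ => hnn y) (mem_filter.2 ⟨mem_univ l, hR⟩))
        rw [mul_assoc]
        refine le_mul_of_one_le_left (mul_nonneg (norm_nonneg _) (monom_nonneg hρ W)) ?_
        exact_mod_cast Nat.one_le_iff_ne_zero.2 hl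
      · have h2 : MvPowerSeries.coeff W (touchingSeries R x) = 0 := by
          rw [MvPowerSeries.coeff_apply, touchingSeries, if_neg h]
        rw [h2, norm_zero, zero_mul]
        exact sum_nonneg fun y _ => hnn y
    refine (sum_le_sum fun W _ => h1 W).trans ?_
    rw [sum_comm]
    refine sum_le_sum fun y _ => ?_
    rw [sum_degreeLE_succ_eq]
    exact mul_le_mul_of_nonneg_left (ih y) (hρ y)

open Classical in
theorem summable_rooted (hrefl : ∀ x, R x x) (hsymm : ∀ x y, R x y → R y x)
    {ρ a : X → ℝ} (hρ : ∀ x, 0 ≤ ρ x)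
    (hKP : ∀ x, ∑ y with R x y, ρ y * Real.exp (a y) ≤ a x) (y : X) :
    Summable (fun W : X →₀ ℕ => (W y : ℝ) * ‖ursellCoeff R W‖ * monom ρ W) ∧
      ∑' W : X →₀ ℕ, (W y : ℝ) * ‖ursellCoeff R W‖ * monom ρ W ≤ ρ y * Real.exp (a y) := by
  have hnn : ∀ W : X →₀ ℕ, 0 ≤ (W y : ℝ) * ‖ursellCoeff R W‖ * monom ρ W := fun W =>
    mul_nonneg (by positivity) (monom_nonneg hρ W)
  have hb : ∀ u : Finset (X →₀ ℕ), ∑ W ∈ u, (W y : ℝ) * ‖ursellCoeff R W‖ * monom ρ W ≤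
      ρ y * Real.exp (a y) := by
    intro u
    have hsub : u ⊆ degreeLE X (u.sup Finsupp.degree + 1) := fun W hW =>
      mem_degreeLE.2 ((le_sup hW).trans (Nat.le_succ _))
    refine (sum_le_sum_of_subset_of_nonneg hsub fun W _ _ => hnn W).trans ?_
    rw [sum_degreeLE_succ_eq]
    exact mul_le_mul_of_nonneg_left (sum_rooted_le hrefl hsymm hρ hKP _ y) (hρ y)
  exact ⟨summable_of_sum_le hnn hb, Real.tsum_le_of_sum_le hnn hb⟩

end KoteckyPreiss

/-! ### The exponential of the cluster series -/

section ClusterExp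

theorem norm_mul_pow_pred_le {t : ℝ} (ht : |t| ≤ 1) (a : ℂ) (k : ℕ) :
    ‖a * (k * (t : ℂ) ^ (k - 1))‖ ≤ k * ‖a‖ := by
  rw [norm_mul, norm_mul, norm_pow, Complex.norm_real, Complex.norm_natCast, Real.norm_eq_abs,
    mul_comm (k : ℝ) ‖a‖]
  refine mul_le_mul_of_nonneg_left ?_ (norm_nonneg _)
  exact mul_le_of_le_one_right (Nat.cast_nonneg _) (pow_le_one₀ (abs_nonneg _) ht)

theorem tsum_mul_tsum_antidiagonal {X : Type*} [DecidableEq X] {f g : (X →₀ ℕ) → ℂ}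
    (hf : Summable fun W => ‖f W‖) (hg : Summable fun W => ‖g W‖) :
    (∑' W, f W) * ∑' W, g W = ∑' W, ∑ p ∈ antidiagonal W, f p.1 * g p.2 :=
  hf.of_norm.tsum_mul_tsum_eq_tsum_sum_antidiagonal hg.of_norm (summable_mul_of_summable_norm hf hg)

/-- A series in powers of `t` with summable coefficients, whose derivative also has summable
coefficients, may be differentiated term by term on `(-1, 1)` and is continuous on `[0, 1]`. -/
theorem hasDerivAt_tsum_pow {ι : Type*} (A : ι → ℂ) (k : ι → ℕ) (h0 : Summable fun i => ‖A i‖)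
    (h1 : Summable fun i => (k i : ℝ) * ‖A i‖) :
    ContinuousOn (fun t : ℝ => ∑' i, A i * (t : ℂ) ^ k i) (Set.Icc 0 1) ∧
    ∀ t ∈ Set.Ioo (-1 : ℝ) 1, HasDerivAt (fun t : ℝ => ∑' i, A i * (t : ℂ) ^ k i)
      (∑' i, A i * (k i * (t : ℂ) ^ (k i - 1))) t := by
  constructor
  · refine continuousOn_tsum (fun i => ?_) h0 fun i t ht => ?_
    · fun_prop
    · rw [norm_mul, norm_pow, Complex.norm_real, Real.norm_of_nonneg ht.1]
      exact mul_le_of_le_one_right (norm_nonneg _) (pow_le_one₀ ht.1 ht.2)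
  · intro t ht
    refine hasDerivAt_tsum_of_isPreconnected (g := fun i (t : ℝ) => A i * (t : ℂ) ^ k i)
      (g' := fun i (t : ℝ) => A i * (k i * (t : ℂ) ^ (k i - 1))) (y₀ := (0 : ℝ)) h1
      isOpen_Ioo isPreconnected_Ioo
      (fun i t _ => ?_) (fun i t ht => ?_) (by norm_num) ?_ ht
    · exact ((hasDerivAt_pow (k i) (t : ℂ)).const_mul (A i)).comp_ofReal
    · exact norm_mul_pow_pred_le (abs_le.2 ⟨ht.1.le, ht.2.le⟩) _ _
    · refine Summable.of_norm_bounded h0 fun i => ?_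
      rw [norm_mul, norm_pow, Complex.norm_real, norm_zero]
      exact mul_le_of_le_one_right (norm_nonneg _) (pow_le_one₀ le_rfl zero_le_one)

variable {X : Type*} [Fintype X]

theorem finite_indep (R : X → X → Prop) : {W : X →₀ ℕ | Indep R W}.Finite := by
  refine (Finsupp.finite_of_degree_le (Fintype.card X)).subset fun W hW => ?_
  change W.degree ≤ _
  rw [Finsupp.degree_eq_sum]
  exact (sum_le_card_nsmul _ _ 1 fun l _ => hW.1 l).trans (by simp)

theorem norm_monom (z : X → ℂ) (W : X →₀ ℕ) : ‖monom z W‖ = monom (fun l => ‖z l‖) W := by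
  simp [monom, norm_prod]

theorem monom_le_monom {ρ σ : X → ℝ} (h0 : ∀ l, 0 ≤ ρ l) (h : ∀ l, ρ l ≤ σ l) (W : X →₀ ℕ) :
    monom ρ W ≤ monom σ W :=
  prod_le_prod (fun l _ => pow_nonneg (h0 l) _) fun l _ => pow_le_pow_left₀ (h0 l) (h l) _

variable {R : X → X → Prop}

theorem ursellCoeff_zero : ursellCoeff R 0 = 0 := by
  have : IsEmpty (Σ l : X, Fin ((0 : X →₀ ℕ) l)) := ⟨fun p => p.2.elim0⟩
  rw [ursellCoeff, connSum_of_isEmpty, zero_div]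

/-- The cluster expansion for an absolutely convergent gas of polymers: along the interpolation
`z_l ↦ z_l t^(k_l)` the cluster series is continuous, and it is a logarithm of the partition
function. -/
theorem exp_tsum_cluster {k : X → ℕ} (hk : ∀ l, 0 < k l) (z : X → ℂ)
    (hs : ∀ y, Summable fun W : X →₀ ℕ => (W y : ℝ) * ‖ursellCoeff R W‖ * ‖monom z W‖) :
    ContinuousOn (fun t : ℝ => ∑' W : X →₀ ℕ,
      ursellCoeff R W * monom z W * (t : ℂ) ^ (∑ l, W l * k l)) (Set.Icc 0 1) ∧
    ∀ t ∈ Set.Icc (0 : ℝ) 1, Complex.exp (∑' W : X →₀ ℕ,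
      ursellCoeff R W * monom z W * (t : ℂ) ^ (∑ l, W l * k l)) =
      ∑ W ∈ (finite_indep R).toFinset, monom z W * (t : ℂ) ^ (∑ l, W l * k l) := by
  classical
  set κ : (X →₀ ℕ) → ℕ := fun W => ∑ l, W l * k l with hκ
  set A : (X →₀ ℕ) → ℂ := fun W => ursellCoeff R W * monom z W with hA
  set B : (X →₀ ℕ) → ℂ := fun W => if Indep R W then monom z W else 0 with hB
  have hκadd : ∀ U V, κ (U + V) = κ U + κ V := fun U V => by
    simp [hκ, add_mul, sum_add_distrib]
  have hA0 : Summable fun W => ‖A W‖ := by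
    refine Summable.of_nonneg_of_le (fun _ => norm_nonneg _) (fun W => ?_)
      (summable_sum fun y (_ : y ∈ univ) => hs y)
    have hnn : ∀ y, 0 ≤ (W y : ℝ) * ‖ursellCoeff R W‖ * ‖monom z W‖ := fun y => by positivity
    by_cases h : W = 0
    · rw [h, hA]
      simp only [ursellCoeff_zero, zero_mul, norm_zero]
      exact sum_nonneg fun y _ => by positivity
    · obtain ⟨y, hy⟩ := Finsupp.ne_iff.1 h
      refine le_trans ?_ (single_le_sum (fun y _ => hnn y) (mem_univ y))
      rw [hA, norm_mul, mul_assoc]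
      refine le_mul_of_one_le_left (by positivity) ?_
      exact_mod_cast Nat.one_le_iff_ne_zero.2 hy
  have hA1 : Summable fun W => (κ W : ℝ) * ‖A W‖ := by
    refine (summable_sum fun y (_ : y ∈ univ) => (hs y).mul_left (k y : ℝ)).congr fun W => ?_
    simp only [hκ, hA, norm_mul, Nat.cast_sum, Nat.cast_mul, sum_mul]
    exact sum_congr rfl fun y _ => by ring
  have hBsupp : ∀ W ∉ (finite_indep R).toFinset, B W = 0 := fun W hW =>
    if_neg fun h => hW ((finite_indep R).mem_toFinset.2 h)
  have hBsum : ∀ f : (X →₀ ℕ) → ℂ, Summable fun W => ‖B W * f W‖ := fun f =>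
    summable_of_ne_finset_zero (s := (finite_indep R).toFinset) fun W hW => by
      rw [hBsupp W hW, zero_mul, norm_zero]
  have hB0 : Summable fun W => ‖B W‖ := by simpa using hBsum 1
  have hB1 : Summable fun W => (κ W : ℝ) * ‖B W‖ := by
    refine (hBsum fun W => (κ W : ℂ)).congr fun W => ?_
    rw [norm_mul, Complex.norm_natCast, mul_comm]
  obtain ⟨hfc, hfd⟩ := hasDerivAt_tsum_pow A κ hA0 hA1
  obtain ⟨hgc, hgd⟩ := hasDerivAt_tsum_pow B κ hB0 hB1
  refine ⟨hfc, ?_⟩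
  have hfin : ∀ t : ℝ, ∑ W ∈ (finite_indep R).toFinset, monom z W * (t : ℂ) ^ κ W =
      ∑' W, B W * (t : ℂ) ^ κ W := by
    intro t
    rw [tsum_eq_sum (s := (finite_indep R).toFinset) fun W hW => by rw [hBsupp W hW, zero_mul]]
    refine sum_congr rfl fun W hW => ?_
    rw [hB]
    simp only
    rw [if_pos (show Indep R W from (finite_indep R).mem_toFinset.1 hW)]
  set f : ℝ → ℂ := fun t => ∑' W, A W * (t : ℂ) ^ κ W with hf
  set g : ℝ → ℂ := fun t => ∑' W, B W * (t : ℂ) ^ κ W with hg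
  -- the logarithmic derivative of the partition function, summed against the weights `k`
  have hcoeff : ∀ W, (κ W : ℂ) * B W = ∑ p ∈ antidiagonal W, ((κ p.1 : ℂ) * A p.1) * B p.2 := by
    intro W
    have h1 : ∀ y, (W y : ℂ) * B W = ∑ p ∈ antidiagonal W, ((p.1 y : ℂ) * A p.1) * B p.2 := by
      intro y
      have h2 := congrArg (· * monom z W) (indep_coeff_eq R W y)
      simp only [sum_mul] at h2
      rw [show (W y : ℂ) * B W = (W y : ℂ) * (if Indep R W then 1 else 0) * monom z W by
        simp only [hB]; split_ifs <;> ring, h2]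
      refine sum_congr rfl fun p hp => ?_
      rw [← HasAntidiagonal.mem_antidiagonal.1 hp, monom_add]
      simp only [hA, hB]
      split_ifs <;> ring
    simp only [hκ, Nat.cast_sum, Nat.cast_mul, sum_mul]
    rw [sum_comm]
    refine sum_congr rfl fun y _ => ?_
    rw [mul_right_comm, h1, sum_mul]
    exact sum_congr rfl fun p _ => by ring
  have hode : ∀ t ∈ Set.Ioo (-1 : ℝ) 1, ∑' W, B W * (κ W * (t : ℂ) ^ (κ W - 1)) =
      (∑' W, A W * (κ W * (t : ℂ) ^ (κ W - 1))) * g t := by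
    intro t ht
    have ht1 : |t| ≤ 1 := abs_le.2 ⟨ht.1.le, ht.2.le⟩
    have hs1 : Summable fun W => ‖A W * (κ W * (t : ℂ) ^ (κ W - 1))‖ := by
      exact Summable.of_nonneg_of_le (fun _ => norm_nonneg _)
        (fun W => norm_mul_pow_pred_le ht1 (A W) (κ W)) hA1
    have hs2 := hBsum fun W => (t : ℂ) ^ κ W
    rw [hg]
    simp only
    rw [tsum_mul_tsum_antidiagonal hs1 hs2]
    refine tsum_congr fun W => ?_
    rw [show B W * (κ W * (t : ℂ) ^ (κ W - 1)) = κ W * B W * (t : ℂ) ^ (κ W - 1) by ring, hcoeff,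
      sum_mul]
    refine sum_congr rfl fun p hp => ?_
    rw [← HasAntidiagonal.mem_antidiagonal.1 hp, hκadd]
    by_cases h0 : κ p.1 = 0
    · simp [h0]
    · rw [show κ p.1 + κ p.2 - 1 = (κ p.1 - 1) + κ p.2 by omega, pow_add]
      ring
  have hconst : ∀ t ∈ Set.Icc (0 : ℝ) 1,
      g t * Complex.exp (-f t) = g 0 * Complex.exp (-f 0) := by
    refine constant_of_has_deriv_right_zero
      (hgc.mul (Complex.continuous_exp.comp_continuousOn hfc.neg)) fun t ht => ?_
    have ht' : t ∈ Set.Ioo (-1 : ℝ) 1 := ⟨by linarith [ht.1], ht.2⟩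
    have hd := (hgd t ht').mul (hfd t ht').neg.cexp
    refine (hd.congr_deriv ?_).hasDerivWithinAt
    rw [hode t ht']
    ring
  have hzero : ∀ C : (X →₀ ℕ) → ℂ, (∀ W, W ≠ 0 → κ W ≠ 0) →
      ∑' W, C W * ((0 : ℝ) : ℂ) ^ κ W = C 0 := by
    intro C hC
    rw [tsum_eq_single 0]
    · simp [hκ]
    · intro W hW
      rw [Complex.ofReal_zero, zero_pow (hC W hW), mul_zero]
  intro t ht
  rw [hfin]
  have hκ0 : ∀ W, W ≠ 0 → κ W ≠ 0 := by
    intro W hW h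
    obtain ⟨y, hy⟩ := Finsupp.ne_iff.1 hW
    have := (sum_eq_zero_iff.1 h) y (mem_univ y)
    exact (mul_ne_zero hy (hk y).ne') this
  have h0 : g 0 * Complex.exp (-f 0) = 1 := by
    rw [hf, hg]
    simp only
    rw [hzero A hκ0, hzero B hκ0]
    simp [hA, hB, ursellCoeff_zero, monom_zero, Indep]
  have := hconst t ht
  rw [h0, Complex.exp_neg, ← div_eq_mul_inv, div_eq_one_iff_eq (Complex.exp_ne_zero _)] at this
  exact this.symm

end ClusterExp

/-! ### Counting connected loops -/

section Exploration

variable {V : Type*}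

theorem sum_powerset_pow (N : Finset V) (q : ℝ) : ∑ A ∈ N.powerset, q ^ card A =
    (1 + q) ^ card N := by
  have := prod_one_add (f := fun _ : V => q) N
  simpa using this.symm

variable [DecidableEq V]

/-- The neighbours of `u` in `U` along edges of `F`. -/
def nbrs (U : Finset V) (u : V) (F : Finset (Sym2 V)) : Finset V :=
  (U.erase u).filter fun w => s(u, w) ∈ F

/-- The edges of `F` not incident to `u`. -/
def awayFrom (u : V) (F : Finset (Sym2 V)) : Finset (Sym2 V) := F.filter fun e => u ∉ e

/-- The known edges after the edges from `u` to `A` have been revealed. -/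
def reveal (j : V → ℕ) (A : Finset V) : V → ℕ := fun w => j w + if w ∈ A then 1 else 0

theorem mk_mem_awayFrom {u a b : V} {F : Finset (Sym2 V)} :
    s(a, b) ∈ awayFrom u F ↔ s(a, b) ∈ F ∧ a ≠ u ∧ b ≠ u := by
  simp only [awayFrom, mem_filter, Sym2.mem_iff, not_or, ne_eq, eq_comm]

theorem sum_reveal {U : Finset V} {j : V → ℕ} {A : Finset V} (hA : A ⊆ U) :
    ∑ w ∈ U, reveal j A w = (∑ w ∈ U, j w) + card A := by
  simp only [reveal, sum_add_distrib]
  congr 1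
  rw [sum_ite_mem, inter_eq_right.2 hA, sum_const, smul_eq_mul, mul_one]

variable [Fintype V] {G : SimpleGraph V}

/-- The vertices of `U` that have an already known edge or an edge in `F`. -/
def touched (U : Finset V) (j : V → ℕ) (F : Finset (Sym2 V)) : Finset V :=
  U.filter fun u => 1 ≤ j u ∨ ∃ w, s(u, w) ∈ F

/-- The possible continuations `F` of a partially explored loop: `U` is the set of vertices whose
edges are not yet known, and `j u` counts the known edges that lead to `u ∈ U`. In the completed
loop every vertex has degree at least two, and everything is connected to a vertex with `j u ≠ 0`
(in terms of adjacency-closed sets). -/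
structure Continues (G : SimpleGraph V) (U : Finset V) (j : V → ℕ) (F : Finset (Sym2 V)) :
    Prop where
  edge : ∀ a b, s(a, b) ∈ F → G.Adj a b ∧ a ∈ U ∧ b ∈ U
  degree : ∀ u ∈ U, (1 ≤ j u ∨ ∃ w, s(u, w) ∈ F) →
    2 ≤ j u + card (univ.filter fun w => s(u, w) ∈ F)
  conn : ∀ S : Set V, (∀ a ∈ S, j a = 0) → (∀ a b, s(a, b) ∈ F → a ∈ S → b ∈ S) →
    ∀ a ∈ S, ∀ b, s(a, b) ∉ F

namespace Continues

variable {U : Finset V} {j : V → ℕ} {F : Finset (Sym2 V)} {u : V}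

theorem mem_nbrs (h : Continues G U j F) {w : V} : w ∈ nbrs U u F ↔ s(u, w) ∈ F := by
  simp only [nbrs, mem_filter, mem_erase, and_iff_right_iff_imp]
  exact fun hw => ⟨(h.edge _ _ hw).1.ne', (h.edge _ _ hw).2.2⟩

theorem eq_union (h : Continues G U j F) :
    F = awayFrom u F ∪ (nbrs U u F).image (fun w => s(u, w)) := by
  ext e
  induction e with
  | h a b =>
    rw [mem_union, mk_mem_awayFrom, mem_image]
    constructor
    · intro he
      by_cases ha : a = u
      · exact Or.inr ⟨b, h.mem_nbrs.2 (ha ▸ he), by rw [ha]⟩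
      · by_cases hb : b = u
        · exact Or.inr ⟨a, h.mem_nbrs.2 (by rw [Sym2.eq_swap]; exact hb ▸ he),
            by rw [Sym2.eq_swap, hb]⟩
        · exact Or.inl ⟨he, ha, hb⟩
    · rintro (he | ⟨w, hw, he⟩)
      · exact he.1
      · exact he ▸ h.mem_nbrs.1 hw

theorem card_eq (h : Continues G U j F) : card F = card (awayFrom u F) + card (nbrs U u F) := by
  conv_lhs => rw [h.eq_union (u := u)]
  rw [card_union_of_disjoint, card_image_of_injective]
  · intro a b hab
    exact Sym2.congr_right.1 hab
  · rw [disjoint_right]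
    intro e he
    obtain ⟨w, -, rfl⟩ := mem_image.1 he
    simp [awayFrom]

theorem touched_eq (h : Continues G U j F) (hu : u ∈ U) (hj : 1 ≤ j u) :
    touched U j F = insert u (touched (U.erase u) (reveal j (nbrs U u F)) (awayFrom u F)) := by
  ext w
  simp only [touched, mem_insert, mem_filter, mem_erase, reveal, h.mem_nbrs, mk_mem_awayFrom]
  constructor
  · rintro ⟨hw, h1⟩
    by_cases hwu : w = u
    · exact Or.inl hwu
    · refine Or.inr ⟨⟨hwu, hw⟩, ?_⟩
      rcases h1 with h1 | ⟨x, hx⟩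
      · left; omega
      · by_cases hxu : x = u
        · left
          rw [if_pos (by rw [Sym2.eq_swap]; exact hxu ▸ hx)]
          omega
        · exact Or.inr ⟨x, hx, hwu, hxu⟩
  · rintro (rfl | ⟨⟨hwu, hw⟩, h1⟩)
    · exact ⟨hu, Or.inl hj⟩
    · refine ⟨hw, ?_⟩
      rcases h1 with h1 | ⟨x, hx, -⟩
      · by_cases hF : s(u, w) ∈ F
        · exact Or.inr ⟨u, by rwa [Sym2.eq_swap]⟩
        · rw [if_neg hF] at h1
          exact Or.inl h1
      · exact Or.inr ⟨x, hx⟩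

theorem continues_awayFrom (h : Continues G U j F) :
    Continues G (U.erase u) (reveal j (nbrs U u F)) (awayFrom u F) where
  edge a b hab := by
    rw [mk_mem_awayFrom] at hab
    obtain ⟨h1, h2, h3⟩ := h.edge a b hab.1
    exact ⟨h1, mem_erase.2 ⟨hab.2.1, h2⟩, mem_erase.2 ⟨hab.2.2, h3⟩⟩
  degree w hw ht := by
    rw [mem_erase] at hw
    have hdeg : reveal j (nbrs U u F) w + card (univ.filter fun x => s(w, x) ∈ awayFrom u F) =
        j w + card (univ.filter fun x => s(w, x) ∈ F) := by
      rw [reveal, add_assoc]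
      congr 1
      by_cases hF : s(u, w) ∈ F
      · rw [if_pos (h.mem_nbrs.2 hF)]
        have : (univ.filter fun x => s(w, x) ∈ F) =
            insert u (univ.filter fun x => s(w, x) ∈ awayFrom u F) := by
          ext x
          simp only [mem_filter, mem_univ, true_and, mem_insert, mk_mem_awayFrom]
          by_cases hx : x = u
          · simp [hx, Sym2.eq_swap, hF]
          · simp [hx, hw.1]
        rw [this, card_insert_of_notMem (by simp [mk_mem_awayFrom]), add_comm]
      · rw [if_neg (fun h' => hF (h.mem_nbrs.1 h')), zero_add]
        congr 1
        ext x
        simp only [mem_filter, mem_univ, true_and, mk_mem_awayFrom]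
        constructor
        · exact fun h' => h'.1
        · refine fun h' => ⟨h', hw.1, ?_⟩
          rintro rfl
          exact hF (by rwa [Sym2.eq_swap])
    rw [hdeg]
    refine h.degree w hw.2 ?_
    rcases ht with ht | ⟨x, hx⟩
    · by_cases hF : s(u, w) ∈ F
      · exact Or.inr ⟨u, by rwa [Sym2.eq_swap]⟩
      · rw [reveal, if_neg (fun h' => hF (h.mem_nbrs.1 h'))] at ht
        exact Or.inl ht
    · exact Or.inr ⟨x, (mk_mem_awayFrom.1 hx).1⟩
  conn S hS hcl a ha b hab := by
    rw [mk_mem_awayFrom] at hab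
    have hu' : ∀ w ∈ S, s(u, w) ∉ F := by
      intro w hw hF
      have := hS w hw
      rw [reveal, if_pos (h.mem_nbrs.2 hF)] at this
      omega
    refine h.conn (S \ {u}) ?_ ?_ a ⟨ha, hab.2.1⟩ b hab.1
    · intro w hw
      have := hS w hw.1
      rw [reveal] at this
      omega
    · rintro x y hxy ⟨hx, hxu⟩
      have hyu : y ≠ u := by
        rintro rfl
        exact hu' x hx (by rwa [Sym2.eq_swap])
      exact ⟨hcl x y (mk_mem_awayFrom.2 ⟨hxy, hxu, hyu⟩) hx, hyu⟩

end Continues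

open Classical in
/-- The weighted number of continuations. -/
noncomputable def continuationSum (G : SimpleGraph V) (U : Finset V) (j : V → ℕ) (q : ℝ) : ℝ :=
  ∑ F with Continues G U j F, (q / 2) ^ card F * 2 ^ card (touched U j F)

/-- One step of the exploration: reveal the edges at `u`. -/
theorem sum_le_sum_reveal {U : Finset V} {j : V → ℕ} {q : ℝ} (hq : 0 ≤ q) {u : V} (hu : u ∈ U)
    (hj : 1 ≤ j u) (𝓕 : Finset (Finset (Sym2 V))) (h𝓕 : ∀ F ∈ 𝓕, Continues G U j F)
    (𝓐 : Finset (Finset V)) (h𝓐 : ∀ F ∈ 𝓕, nbrs U u F ∈ 𝓐) :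
    ∑ F ∈ 𝓕, (q / 2) ^ card F * 2 ^ card (touched U j F) ≤
      ∑ A ∈ 𝓐, 2 * (q / 2) ^ card A * continuationSum G (U.erase u) (reveal j A) q := by
  classical
  simp only [continuationSum, mul_sum]
  rw [sum_sigma']
  have hinj : Set.InjOn (fun F => (⟨nbrs U u F, awayFrom u F⟩ : (_ : Finset V) × Finset (Sym2 V)))
      𝓕 := by
    intro F hF F' hF' heq
    simp only [Sigma.mk.injEq, heq_eq_eq] at heq
    rw [(h𝓕 F hF).eq_union (u := u), (h𝓕 F' hF').eq_union (u := u), heq.1, heq.2]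
  have h1 : ∑ F ∈ 𝓕, (q / 2) ^ card F * 2 ^ card (touched U j F) =
      ∑ p ∈ 𝓕.image (fun F => (⟨nbrs U u F, awayFrom u F⟩ : (_ : Finset V) × Finset (Sym2 V))),
        2 * (q / 2) ^ card p.1 *
          ((q / 2) ^ card p.2 * 2 ^ card (touched (U.erase u) (reveal j p.1) p.2)) := by
    rw [sum_image hinj]
    refine sum_congr rfl fun F hF => ?_
    rw [(h𝓕 F hF).card_eq (u := u), (h𝓕 F hF).touched_eq hu hj,
      card_insert_of_notMem (by simp [touched]), pow_add, pow_succ]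
    ring
  rw [h1]
  refine sum_le_sum_of_subset_of_nonneg ?_ fun p _ _ => by positivity
  intro p hp
  obtain ⟨F, hF, rfl⟩ := mem_image.1 hp
  exact mem_sigma.2 ⟨h𝓐 F hF, mem_filter.2 ⟨mem_univ _, (h𝓕 F hF).continues_awayFrom⟩⟩

open Classical in
/-- In a graph of maximal degree `D + 1`, each vertex of the exploration other than the first one
has at most `D` unknown edges, so its choice of edges costs at most `(1 + q) ^ D ≤ 2`; if only one
of its edges is known, then the empty choice is excluded, and the cost is at most `1`. -/
theorem continuationSum_le {D : ℕ} (hG : ∀ u, card (univ.filter fun w => G.Adj u w) ≤ D + 1)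
    {q : ℝ} (hq : 0 ≤ q) (hqD : (1 + q) ^ D ≤ 2) (U : Finset V) (j : V → ℕ)
    (hj : ∀ u ∈ U, 1 ≤ j u → ∃ w ∉ U, G.Adj u w) :
    continuationSum G U j q ≤ 2 ^ ∑ u ∈ U, j u := by
  induction hn : card U generalizing U j with
  | zero =>
    rw [card_eq_zero] at hn
    subst hn
    refine (sum_le_sum_of_subset_of_nonneg (t := {∅}) ?_ fun _ _ _ => by positivity).trans
      (by simp [touched])
    intro F hF
    rw [mem_singleton]
    refine eq_empty_of_forall_notMem fun e he => ?_
    induction e with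
    | h a b => simpa using ((mem_filter.1 hF).2.edge a b he).2.1
  | succ n ih =>
    by_cases hact : ∃ u ∈ U, 1 ≤ j u
    · obtain ⟨u, hu, hju⟩ := hact
      set N : Finset V := (U.erase u).filter fun w => G.Adj u w with hN
      have hNcard : card N ≤ D := by
        obtain ⟨w, hw, huw⟩ := hj u hu hju
        have hsub : insert w N ⊆ univ.filter fun w => G.Adj u w := by
          intro x hx
          rcases mem_insert.1 hx with rfl | hx
          · simpa using huw
          · simpa using (mem_filter.1 hx).2
        have := (card_le_card hsub).trans (hG u)
        rw [card_insert_of_notMem] at this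
        · omega
        · intro h
          exact hw (mem_of_mem_erase (mem_filter.1 h).1)
      set 𝓐 : Finset (Finset V) := N.powerset.filter fun A => j u = 1 → A ≠ ∅ with h𝓐
      have hstep := sum_le_sum_reveal hq hu hju (univ.filter fun F => Continues G U j F)
        (fun F hF => (mem_filter.1 hF).2) 𝓐 (by
          intro F hF
          have hF := (mem_filter.1 hF).2
          rw [h𝓐, mem_filter, mem_powerset]
          refine ⟨fun w hw => ?_, fun h1 h0 => ?_⟩
          · exact mem_filter.2 ⟨(mem_filter.1 hw).1, (hF.edge _ _ (hF.mem_nbrs.1 hw)).1⟩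
          · have := hF.degree u hu (Or.inl hju)
            have h2 : (univ.filter fun w => s(u, w) ∈ F) = nbrs U u F := by
              ext w
              rw [hF.mem_nbrs]; simp
            rw [h2, h0, h1] at this
            simp at this)
      refine hstep.trans ?_
      have hbound : ∀ A ∈ 𝓐, 2 * (q / 2) ^ card A *
          continuationSum G (U.erase u) (reveal j A) q ≤
          2 * 2 ^ (∑ w ∈ U.erase u, j w) * q ^ card A := by
        intro A hA
        have hAN : A ⊆ N := mem_powerset.1 (mem_filter.1 hA).1
        have h1 := ih (U.erase u) (reveal j A) (by
          intro w hw hjw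
          by_cases hwA : w ∈ A
          · exact ⟨u, notMem_erase u U, (mem_filter.1 (hAN hwA)).2.symm⟩
          · rw [reveal, if_neg hwA] at hjw
            obtain ⟨x, hx, hwx⟩ := hj w (mem_of_mem_erase hw) hjw
            exact ⟨x, fun h => hx (mem_of_mem_erase h), hwx⟩) (by
          rw [card_erase_of_mem hu, hn]; rfl)
        rw [sum_reveal (hAN.trans (filter_subset _ _)), pow_add] at h1
        refine (mul_le_mul_of_nonneg_left h1 (by positivity)).trans (le_of_eq ?_)
        rw [div_pow]
        field_simp
      refine (sum_le_sum hbound).trans ?_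
      rw [← mul_sum, ← add_sum_erase _ _ hu, pow_add]
      have hall := sum_powerset_pow N q
      have hpow : (1 + q) ^ card N ≤ 2 :=
        (pow_le_pow_right₀ (by linarith) hNcard).trans hqD
      have hfac : 2 * ∑ A ∈ 𝓐, q ^ card A ≤ 2 ^ j u := by
        by_cases h1 : j u = 1
        · have h2 : 𝓐 = N.powerset.erase ∅ := by
            ext A
            simp [h𝓐, h1, and_comm]
          rw [h2, sum_erase_eq_sub (empty_mem_powerset N), hall, h1]
          simp
          linarith
        · have h2 : ∑ A ∈ 𝓐, q ^ card A ≤ ∑ A ∈ N.powerset, q ^ card A :=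
            sum_le_sum_of_subset_of_nonneg (filter_subset _ _) fun _ _ _ => by positivity
          have h3 : (2 : ℝ) ^ 2 ≤ 2 ^ j u := pow_le_pow_right₀ (by norm_num) (by omega)
          linarith
      calc 2 * 2 ^ (∑ w ∈ U.erase u, j w) * ∑ A ∈ 𝓐, q ^ card A
          = (2 * ∑ A ∈ 𝓐, q ^ card A) * 2 ^ (∑ w ∈ U.erase u, j w) := by ring
        _ ≤ _ := mul_le_mul_of_nonneg_right hfac (by positivity)
    · push Not at hact
      refine (sum_le_sum_of_subset_of_nonneg (t := {∅}) ?_ fun _ _ _ => by positivity).trans ?_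
      · intro F hF
        rw [mem_singleton]
        have hF := (mem_filter.1 hF).2
        refine eq_empty_of_forall_notMem fun e he => ?_
        induction e with
        | h a b =>
          exact hF.conn U (fun a ha => by have := hact a ha; omega)
            (fun a b hab _ => (hF.edge a b hab).2.2) a (hF.edge a b he).2.1 b he
      · have : touched U j ∅ = ∅ := by
          rw [touched, filter_eq_empty_iff]
          intro u hu
          have := hact u hu
          simp
          omega
        rw [sum_singleton, this]
        simpa using one_le_pow₀ (n := ∑ u ∈ U, j u) (one_le_two (α := ℝ))

open Classical in
/-- The first step of the exploration, at a vertex of degree at least two in the loop. -/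
theorem sum_continues_root_le {D : ℕ} (hG : ∀ u, card (univ.filter fun w => G.Adj u w) ≤ D + 1)
    {q : ℝ} (hq : 0 ≤ q) (hqD : (1 + q) ^ D ≤ 2) (v : V) (𝓕 : Finset (Finset (Sym2 V)))
    (h𝓕 : ∀ F ∈ 𝓕, Continues G univ (Pi.single v 1) F)
    (hdeg : ∀ F ∈ 𝓕, 2 ≤ card (univ.filter fun w => s(v, w) ∈ F)) :
    ∑ F ∈ 𝓕, (q / 2) ^ card F * 2 ^ card (touched univ (Pi.single v 1) F) ≤
      2 * ((1 + q) ^ (D + 1) - 1 - (D + 1) * q) := by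
  set N : Finset V := univ.filter fun w => G.Adj v w with hN
  have hmem : ∀ F ∈ 𝓕, nbrs univ v F ∈ N.powerset.filter fun A => 2 ≤ card A := by
    intro F hF
    rw [mem_filter, mem_powerset]
    refine ⟨fun w hw => ?_, ?_⟩
    · exact mem_filter.2 ⟨mem_univ _, ((h𝓕 F hF).edge _ _ ((h𝓕 F hF).mem_nbrs.1 hw)).1⟩
    · have h2 : (univ.filter fun w => s(v, w) ∈ F) = nbrs univ v F := by
        ext w
        rw [(h𝓕 F hF).mem_nbrs]; simp
      exact h2 ▸ hdeg F hF
  refine (sum_le_sum_reveal hq (mem_univ v) (by simp) 𝓕 h𝓕 _ hmem).trans ?_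
  have hbound : ∀ A ∈ N.powerset.filter fun A => 2 ≤ card A, 2 * (q / 2) ^ card A *
      continuationSum G (univ.erase v) (reveal (Pi.single v 1) A) q ≤ 2 * q ^ card A := by
    intro A hA
    have hAN : A ⊆ N := mem_powerset.1 (mem_filter.1 hA).1
    have hA' : A ⊆ univ.erase v := fun w hw =>
      mem_erase.2 ⟨(mem_filter.1 (hAN hw)).2.ne', mem_univ _⟩
    have h1 := continuationSum_le hG hq hqD (univ.erase v) (reveal (Pi.single v 1) A) (by
      intro w hw hjw
      by_cases hwA : w ∈ A
      · exact ⟨v, notMem_erase v _, (mem_filter.1 (hAN hwA)).2.symm⟩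
      · rw [reveal, if_neg hwA, Pi.single_eq_of_ne (mem_erase.1 hw).1] at hjw
        omega)
    have h0 : ∑ w ∈ univ.erase v, (Pi.single v 1 : V → ℕ) w = 0 :=
      sum_eq_zero fun w hw => Pi.single_eq_of_ne (mem_erase.1 hw).1 _
    rw [sum_reveal hA', h0, zero_add] at h1
    refine (mul_le_mul_of_nonneg_left h1 (by positivity)).trans (le_of_eq ?_)
    rw [div_pow]
    field_simp
  refine (sum_le_sum hbound).trans ?_
  rw [← mul_sum]
  refine mul_le_mul_of_nonneg_left ?_ zero_le_two
  have hsplit : ∑ A ∈ N.powerset.filter (fun A => 2 ≤ card A), q ^ card A =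
      (1 + q) ^ card N - 1 - card N * q := by
    rw [← sum_powerset_pow, ← sum_filter_add_sum_filter_not N.powerset (fun A => 2 ≤ card A)]
    have h1 : ∑ A ∈ N.powerset.filter (fun A => ¬ 2 ≤ card A), q ^ card A = 1 + card N * q := by
      have h2 : N.powerset.filter (fun A => ¬ 2 ≤ card A) =
          N.powersetCard 0 ∪ N.powersetCard 1 := by
        ext A
        simp only [mem_filter, mem_powerset, mem_union, mem_powersetCard]
        constructor
        · rintro ⟨h, h'⟩
          have : card A = 0 ∨ card A = 1 := by omega
          exact this.imp (⟨h, ·⟩) (⟨h, ·⟩)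
        · rintro (⟨h, h'⟩ | ⟨h, h'⟩) <;> exact ⟨h, by omega⟩
      rw [h2, sum_union (pairwise_disjoint_powersetCard N (by norm_num : (0 : ℕ) ≠ 1)),
        powersetCard_zero, sum_singleton, sum_congr rfl fun A hA => by
          rw [(mem_powersetCard.1 hA).2]]
      simp
    rw [h1]
    ring
  rw [hsplit]
  have hmono : Monotone fun n : ℕ => (1 + q) ^ n - 1 - n * q := by
    refine monotone_nat_of_le_succ fun n => ?_
    have : 1 ≤ (1 + q) ^ n := one_le_pow₀ (by linarith)
    push_cast
    rw [pow_succ]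
    nlinarith
  have := hmono (hG v)
  push_cast at this
  exact this

end Exploration

section LoopCount

variable {V : Type*} {G : SimpleGraph V}

theorem verts_subset_of_closed {C : G.Subgraph} (hC : C.Connected) {S : Set V} {a : V}
    (ha : a ∈ C.verts) (haS : a ∈ S) (hS : ∀ x y, C.Adj x y → x ∈ S → y ∈ S) : C.verts ⊆ S := by
  intro b hb
  have key : ∀ x y : C.verts, C.coe.Walk x y → (x : V) ∈ S → (y : V) ∈ S := by
    intro x y w
    induction w with
    | nil => exact id
    | cons h _ ih => exact fun hx => ih (hS _ _ h hx)
  exact key ⟨a, ha⟩ ⟨b, hb⟩ (hC.coe.preconnected _ _).some haS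

variable [Fintype V]

open Classical in
/-- The edges of a loop. -/
noncomputable def Loop.edges (l : Loop G) : Finset (Sym2 V) := l.1.edgeSet.toFinset

theorem Loop.mem_edges (l : Loop G) {a b : V} : s(a, b) ∈ l.edges ↔ l.1.Adj a b := by
  simp [Loop.edges]

theorem Loop.card_edges (l : Loop G) : card l.edges = l.weight := by
  classical
  rw [Loop.edges, Loop.weight, Set.ncard_eq_toFinset_card']

variable [DecidableEq V]

theorem Loop.two_le_card (l : Loop G) {a : V} (ha : a ∈ l.1.verts) :
    2 ≤ card (univ.filter fun w => s(a, w) ∈ l.edges) := by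
  have h := l.2.1 a ha
  rwa [← Set.ncard_coe_finset, show ((univ.filter fun w => s(a, w) ∈ l.edges : Finset V) : Set V) =
    l.1.neighborSet a by ext w; simp [l.mem_edges]]

theorem Loop.exists_adj (l : Loop G) {a : V} (ha : a ∈ l.1.verts) : ∃ b, l.1.Adj a b := by
  have := l.two_le_card ha
  obtain ⟨b, hb⟩ := card_pos.1 (by omega : 0 < card (univ.filter fun w => s(a, w) ∈ l.edges))
  exact ⟨b, l.mem_edges.1 (mem_filter.1 hb).2⟩

theorem Loop.edges_injective : Function.Injective (Loop.edges : Loop G → _) := by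
  intro l l' h
  have hadj : ∀ a b, l.1.Adj a b ↔ l'.1.Adj a b := fun a b => by
    rw [← l.mem_edges, ← l'.mem_edges, h]
  refine Subtype.ext (SimpleGraph.Subgraph.ext ?_ (by ext a b; exact hadj a b))
  ext a
  constructor
  · intro ha
    obtain ⟨b, hb⟩ := l.exists_adj ha
    exact ((hadj a b).1 hb).fst_mem
  · intro ha
    obtain ⟨b, hb⟩ := l'.exists_adj ha
    exact ((hadj a b).2 hb).fst_mem

theorem Loop.continues (l : Loop G) {v : V} (hv : v ∈ l.1.verts) :
    Continues G univ (Pi.single v 1) l.edges where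
  edge a b hab := ⟨(l.mem_edges.1 hab).adj_sub, mem_univ _, mem_univ _⟩
  degree u _ h := by
    have hu : u ∈ l.1.verts := by
      rcases h with h | ⟨w, hw⟩
      · by_cases huv : u = v
        · exact huv ▸ hv
        · rw [Pi.single_eq_of_ne huv] at h
          omega
      · exact (l.mem_edges.1 hw).fst_mem
    exact (l.two_le_card hu).trans (Nat.le_add_left _ _)
  conn S hS hcl a ha b hab := by
    have := verts_subset_of_closed l.2.2 (l.mem_edges.1 hab).fst_mem ha
      (fun x y h => hcl x y (l.mem_edges.2 h)) hv
    simpa using hS v this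

theorem Loop.touched_eq (l : Loop G) {v : V} (hv : v ∈ l.1.verts) :
    (touched univ (Pi.single v 1) l.edges : Set V) = l.1.verts := by
  ext u
  simp only [touched, coe_filter, mem_univ, true_and, Set.mem_ofPred_eq]
  constructor
  · rintro (h | ⟨w, hw⟩)
    · by_cases huv : u = v
      · exact huv ▸ hv
      · rw [Pi.single_eq_of_ne huv] at h
        omega
    · exact (l.mem_edges.1 hw).fst_mem
  · intro hu
    obtain ⟨w, hw⟩ := l.exists_adj hu
    exact Or.inr ⟨w, l.mem_edges.2 hw⟩

theorem Loop.ncard_verts_le (l : Loop G) : l.1.verts.ncard ≤ l.weight := by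
  classical
  have h := l.1.spanningCoe.sum_degrees_eq_twice_card_edges
  have h2 : card l.1.spanningCoe.edgeFinset = l.weight := by
    rw [← l.card_edges]
    congr 1
    ext e
    simp [Loop.edges]
  have h3 : 2 * l.1.verts.ncard ≤ ∑ v, l.1.spanningCoe.degree v := by
    rw [Set.ncard_eq_toFinset_card', mul_comm, ← smul_eq_mul]
    refine (card_nsmul_le_sum l.1.verts.toFinset _ 2 fun v hv => ?_).trans
      (sum_le_sum_of_subset (subset_univ _))
    refine (l.two_le_card (Set.mem_toFinset.1 hv)).trans (card_le_card fun w hw => ?_)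
    simpa [l.mem_edges] using hw
  omega

theorem Loop.three_le_ncard_verts (l : Loop G) : 3 ≤ l.1.verts.ncard := by
  classical
  obtain ⟨⟨v, hv⟩⟩ := l.2.2.coe.nonempty
  have h1 := l.two_le_card hv
  have h2 : v ∉ univ.filter fun w => s(v, w) ∈ l.edges := fun h =>
    (l.mem_edges.1 (mem_filter.1 h).2).adj_sub.ne rfl
  have h3 : (insert v (univ.filter fun w => s(v, w) ∈ l.edges) : Finset V) ⊆
      l.1.verts.toFinset := by
    intro w hw
    rw [Set.mem_toFinset]
    rcases mem_insert.1 hw with rfl | hw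
    · exact hv
    · exact (l.mem_edges.1 (mem_filter.1 hw).2).snd_mem
  have := card_le_card h3
  rw [card_insert_of_notMem h2] at this
  rw [Set.ncard_eq_toFinset_card']
  omega

/-- The exploration weight `q = 2 / (3 D)` meets the hypothesis of `continuationSum_le`. -/
theorem one_add_pow_le_two {D : ℕ} (hD : 1 ≤ D) : (1 + 2 / (3 * (D : ℝ))) ^ D ≤ 2 := by
  have hD' : (0 : ℝ) < D := by exact_mod_cast hD
  have h1 : (1 + 2 / (3 * (D : ℝ))) ^ D ≤ Real.exp (2 / 3) := by
    have : Real.exp (2 / 3) = Real.exp (2 / (3 * (D : ℝ))) ^ D := by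
      rw [← Real.exp_nat_mul]
      congr 1
      field_simp
    rw [this]
    refine pow_le_pow_left₀ (by positivity) ?_ D
    rw [add_comm]
    exact Real.add_one_le_exp _
  refine h1.trans ?_
  have h2 : Real.exp (2 / 3) ^ 3 ≤ 2 ^ 3 := by
    rw [← Real.exp_nat_mul, show ((3 : ℕ) : ℝ) * (2 / 3) = (2 : ℕ) * 1 by norm_num,
      Real.exp_nat_mul]
    have := Real.exp_one_lt_d9
    nlinarith [Real.exp_pos 1]
  exact le_of_pow_le_pow_left₀ (by norm_num) (by norm_num) h2

theorem root_factor_le {D : ℕ} (hD : 1 ≤ D) :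
    (1 + 2 / (3 * (D : ℝ))) ^ (D + 1) - 1 - (D + 1) * (2 / (3 * (D : ℝ))) ≤ 16 / 27 := by
  rcases (by omega : D = 1 ∨ D = 2 ∨ 3 ≤ D) with rfl | rfl | h3
  · norm_num
  · norm_num
  · have h3' : (3 : ℝ) ≤ D := by exact_mod_cast h3
    have h1 := one_add_pow_le_two hD
    set q : ℝ := 2 / (3 * (D : ℝ)) with hq
    have hqD : D * q = 2 / 3 := by rw [hq]; field_simp
    have hq9 : q ≤ 2 / 9 := by
      rw [hq, div_le_div_iff₀ (by positivity) (by norm_num)]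
      linarith
    have hq0 : 0 ≤ q := by positivity
    rw [pow_succ]
    nlinarith

/-- The activities are compared with the exploration weights at `q = 2 / (3 D)`. The excess
`|l| - |V(l)|` is absorbed by `3 / 2 ≤ √e`, and `27 / 64 = (3 / 4) ^ 3` comes from the at least
three vertices of a loop. -/
theorem Loop.term_le (l : Loop G) {D : ℝ} (hD : 0 < D) :
    Real.exp (-(Real.log (2 * D) + 1 / 2) * l.weight) * Real.exp ((l.1.verts.ncard : ℝ) / 2) ≤
      27 / 64 * ((2 / (3 * D) / 2) ^ l.weight * 2 ^ l.1.verts.ncard) := by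
  obtain ⟨e, he⟩ := Nat.exists_eq_add_of_le l.ncard_verts_le
  obtain ⟨n, hn⟩ := Nat.exists_eq_add_of_le l.three_le_ncard_verts
  have h1 : Real.exp (-(Real.log (2 * D) + 1 / 2) * l.weight) *
      Real.exp ((l.1.verts.ncard : ℝ) / 2) =
      ((2 * D)⁻¹) ^ l.weight * (Real.exp (1 / 2))⁻¹ ^ e := by
    rw [← Real.exp_neg, ← Real.exp_nat_mul, ← Real.exp_log (inv_pos.2 (by positivity : 0 < 2 * D)),
      ← Real.exp_nat_mul, ← Real.exp_add, ← Real.exp_add, Real.log_inv, he]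
    congr 1
    push_cast
    ring
  have h2 : 3 / 2 * (Real.exp (1 / 2))⁻¹ ≤ 1 := by
    rw [← div_eq_mul_inv, div_le_one (Real.exp_pos _)]
    have := Real.add_one_le_exp (1 / 2 : ℝ)
    linarith
  have h3 : (3 / 2 * (Real.exp (1 / 2))⁻¹) ^ e ≤ 1 := pow_le_one₀ (by positivity) h2
  have h4 : (3 / 4 : ℝ) ^ n ≤ 1 := pow_le_one₀ (by norm_num) (by norm_num)
  have h5 : ((2 * D)⁻¹) ^ l.weight * (Real.exp (1 / 2))⁻¹ ^ e =
      (27 / 64 * ((2 / (3 * D) / 2) ^ l.weight * 2 ^ l.1.verts.ncard)) *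
        ((3 / 4 : ℝ) ^ n * (3 / 2 * (Real.exp (1 / 2))⁻¹) ^ e) := by
    have h6 : (2 * D)⁻¹ = (2 / (3 * D) / 2) * (3 / 2) := by field_simp
    have h7 : (27 / 64 : ℝ) * (3 / 4) ^ n = (3 / 2) ^ l.1.verts.ncard / 2 ^ l.1.verts.ncard := by
      rw [← div_pow, hn, pow_add]
      norm_num
    have h8 : (3 / 2 : ℝ) ^ l.weight = (3 / 2) ^ l.1.verts.ncard * (3 / 2) ^ e := by
      rw [he, pow_add]
    calc _ = (2 / (3 * D) / 2) ^ l.weight * (3 / 2) ^ l.weight * (Real.exp (1 / 2))⁻¹ ^ e := by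
          rw [h6, mul_pow]
      _ = (2 / (3 * D) / 2) ^ l.weight * 2 ^ l.1.verts.ncard * (27 / 64 * (3 / 4) ^ n) *
          ((3 / 2) ^ e * (Real.exp (1 / 2))⁻¹ ^ e) := by
          rw [h7, h8]; field_simp
      _ = _ := by rw [← mul_pow]; ring
  rw [h1, h5]
  refine mul_le_of_le_one_right (by positivity) ?_
  exact mul_le_one₀ h4 (by positivity) h3

open Classical in
/-- The loops through a given vertex satisfy the Kotecký–Preiss condition with
`a_l = |V(l)| / 2`. -/
theorem sum_loops_through_le [Fintype (Loop G)] {D : ℕ} (hD : 1 ≤ D)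
    (hG : ∀ u, card (univ.filter fun w => G.Adj u w) ≤ D + 1) (v : V) :
    ∑ l : Loop G with v ∈ l.1.verts, Real.exp (-(Real.log (2 * D) + 1 / 2) * l.weight) *
      Real.exp ((l.1.verts.ncard : ℝ) / 2) ≤ 1 / 2 := by
  have hD' : (0 : ℝ) < D := by exact_mod_cast hD
  refine (sum_le_sum fun l _ => l.term_le hD').trans ?_
  rw [← mul_sum]
  have h := sum_continues_root_le hG (q := 2 / (3 * (D : ℝ))) (by positivity)
    (one_add_pow_le_two hD) v ((univ.filter fun l : Loop G => v ∈ l.1.verts).image Loop.edges)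
    (by
      intro F hF
      obtain ⟨l, hl, rfl⟩ := mem_image.1 hF
      exact l.continues (mem_filter.1 hl).2) (by
      intro F hF
      obtain ⟨l, hl, rfl⟩ := mem_image.1 hF
      exact l.two_le_card (mem_filter.1 hl).2)
  rw [sum_image Loop.edges_injective.injOn] at h
  have h2 : ∑ l : Loop G with v ∈ l.1.verts, (2 / (3 * (D : ℝ)) / 2) ^ l.weight *
      2 ^ l.1.verts.ncard ≤ 2 * (16 / 27) := by
    refine le_trans (le_of_eq (sum_congr rfl fun l hl => ?_)) (h.trans ?_)
    · rw [l.card_edges, ← l.touched_eq (mem_filter.1 hl).2, Set.ncard_coe_finset]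
    · exact mul_le_mul_of_nonneg_left (root_factor_le hD) zero_le_two
  linarith

end LoopCount

/-! ### Contractions with vacuum and excited edges -/

section Contraction

variable {V : Type*} {χ : ℕ} (μ : Messages V χ)

theorem overlap_comm (v w : V) : overlap μ v w = overlap μ w v :=
  sum_congr rfl fun _ _ => mul_comm _ _

theorem vacuumOp_apply (v w : V) (i j : Fin χ) :
    vacuumOp μ v w i j = μ w v i * μ v w j / overlap μ v w := rfl

theorem vacuumOp_transpose (v w : V) : (vacuumOp μ v w).transpose = vacuumOp μ w v := by
  ext i j
  rw [Matrix.transpose_apply, vacuumOp_apply, vacuumOp_apply, overlap_comm, mul_comm (μ w v j)]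

theorem excitedOp_transpose (v w : V) : (excitedOp μ v w).transpose = excitedOp μ w v := by
  rw [excitedOp, Matrix.transpose_sub, vacuumOp_transpose, Matrix.transpose_one, excitedOp]

variable {μ} in
/-- The excited projector annihilates the outgoing message. -/
theorem sum_mul_excitedOp {v w : V} (h : overlap μ v w ≠ 0) (j : Fin χ) :
    ∑ i, μ v w i * excitedOp μ v w i j = 0 := by
  simp only [excitedOp, Matrix.sub_apply, vacuumOp_apply, mul_sub, sum_sub_distrib]
  have h1 : ∑ i, μ v w i * (μ w v i * μ v w j / overlap μ v w) = μ v w j := by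
    have : ∑ i, μ v w i * (μ w v i * μ v w j / overlap μ v w) =
        overlap μ v w * (μ v w j / overlap μ v w) := by
      rw [overlap, sum_mul]
      exact sum_congr rfl fun i _ => by ring
    rw [this]
    field_simp
  rw [h1]
  simp [Matrix.one_apply]

variable {G : SimpleGraph V}

theorem edgeDart_edge (e : G.edgeSet) : (edgeDart e).edge = e.1 := Quot.out_eq e.1

theorem edgeDart_mk (e : G.edgeSet) : s((edgeDart e).fst, (edgeDart e).snd) = e.1 :=
  edgeDart_edge e

/-- The factor of an edge in a contraction. -/
noncomputable def edgeFactor (M : V → V → Matrix (Fin χ) (Fin χ) ℂ)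
    (x : (v : V) → G.neighborSet v → Fin χ) (e : G.edgeSet) : ℂ :=
  M (edgeDart e).fst (edgeDart e).snd
    (x (edgeDart e).fst ⟨(edgeDart e).snd, (edgeDart e).adj⟩)
    (x (edgeDart e).snd ⟨(edgeDart e).fst, (edgeDart e).adj.symm⟩)

theorem mem_neighborSet_of_mem_edgeSet {v w : V} (h : s(v, w) ∈ G.edgeSet) :
    w ∈ G.neighborSet v := h

theorem mem_neighborSet_of_mem_edgeSet' {v w : V} (h : s(v, w) ∈ G.edgeSet) :
    v ∈ G.neighborSet w :=
  (show G.Adj v w from h).symm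

theorem mem_edgeSet_of_mem_neighborSet {v w : V} (h : w ∈ G.neighborSet v) :
    s(v, w) ∈ G.edgeSet := h

theorem edgeFactor_mk {M : V → V → Matrix (Fin χ) (Fin χ) ℂ}
    (hM : ∀ v w, (M v w).transpose = M w v) (x : (v : V) → G.neighborSet v → Fin χ) {v w : V}
    (h : s(v, w) ∈ G.edgeSet) :
    edgeFactor M x ⟨s(v, w), h⟩ = M v w (x v ⟨w, mem_neighborSet_of_mem_edgeSet h⟩)
      (x w ⟨v, mem_neighborSet_of_mem_edgeSet' h⟩) := by
  have key : ∀ d : G.Dart, d.edge = s(v, w) → M d.fst d.snd (x d.fst ⟨d.snd, d.adj⟩)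
      (x d.snd ⟨d.fst, d.adj.symm⟩) = M v w (x v ⟨w, mem_neighborSet_of_mem_edgeSet h⟩)
        (x w ⟨v, mem_neighborSet_of_mem_edgeSet' h⟩) := by
    rintro ⟨⟨a, b⟩, hab⟩ hd
    rcases Sym2.eq_iff.1 (show s(a, b) = s(v, w) from hd) with ⟨rfl, rfl⟩ | ⟨rfl, rfl⟩
    · rfl
    · rw [← hM]; rfl
  exact key _ (edgeDart_edge _)

variable [DecidableEq V]

/-- The matrix on each edge when the edges in `F` are excited and all others are in the vacuum. -/
noncomputable def edgeOp (F : Finset (Sym2 V)) (v w : V) : Matrix (Fin χ) (Fin χ) ℂ :=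
  if s(v, w) ∈ F then excitedOp μ v w else vacuumOp μ v w

theorem edgeOp_transpose (F : Finset (Sym2 V)) (v w : V) :
    (edgeOp μ F v w).transpose = edgeOp μ F w v := by
  rw [edgeOp, edgeOp, Sym2.eq_swap]
  split_ifs
  exacts [excitedOp_transpose μ v w, vacuumOp_transpose μ v w]

variable [Fintype V] [DecidableRel G.Adj] (T : Network G χ)

theorem contractWith_eq (M : V → V → Matrix (Fin χ) (Fin χ) ℂ) :
    contractWith T M = ∑ x : (v : V) → G.neighborSet v → Fin χ,
      (∏ v, T v (x v)) * ∏ e : G.edgeSet, edgeFactor M x e := rfl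

/-- The contraction with excited projectors on the edges in `F`, and vacuum on all other edges. -/
noncomputable def edgeContraction (F : Finset (Sym2 V)) : ℂ := contractWith T (edgeOp μ F)

theorem loopCorrection_eq (l : Loop G) : loopCorrection T μ l = edgeContraction μ T l.edges := by
  classical
  rw [loopCorrection, edgeContraction]
  congr 1
  ext v w
  simp only [edgeOp, l.mem_edges]

theorem interpolatedPartition_eq (t : ℝ) :
    interpolatedPartition T μ t =
      ∑ F ∈ G.edgeFinset.powerset, (t : ℂ) ^ card F * edgeContraction μ T F := by
  have h1 : ∑ F ∈ G.edgeFinset.powerset, (t : ℂ) ^ card F * edgeContraction μ T F =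
      ∑ S : Finset G.edgeSet, (t : ℂ) ^ card S *
        edgeContraction μ T (S.map (Function.Embedding.subtype _)) := by
    symm
    refine sum_nbij (fun S => S.map (Function.Embedding.subtype _)) ?_ ?_ ?_ ?_
    · intro S _
      rw [mem_powerset]
      intro e he
      obtain ⟨e, -, rfl⟩ := mem_map.1 he
      exact SimpleGraph.mem_edgeFinset.2 e.2
    · exact fun _ _ _ _ h => map_injective _ h
    · intro F hF
      refine ⟨univ.filter fun e : G.edgeSet => e.1 ∈ F, by simp, ?_⟩
      ext e
      simp only [mem_map, mem_filter, mem_univ, true_and, Function.Embedding.subtype_apply]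
      constructor
      · rintro ⟨e, he, rfl⟩; exact he
      · exact fun he => ⟨⟨e, SimpleGraph.mem_edgeFinset.1 (mem_powerset.1 hF he)⟩, he, rfl⟩
    · intro S _
      rw [card_map]
  rw [h1, interpolatedPartition, contractWith_eq]
  simp only [edgeContraction, contractWith_eq, mul_sum]
  rw [sum_comm]
  refine sum_congr rfl fun x _ => ?_
  have h2 : ∀ e : G.edgeSet,
      edgeFactor (fun v w => vacuumOp μ v w + (t : ℂ) • excitedOp μ v w) x e =
      t * edgeFactor (excitedOp μ) x e + edgeFactor (vacuumOp μ) x e := fun e => by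
    simp only [edgeFactor, Matrix.add_apply, Matrix.smul_apply, smul_eq_mul]
    ring
  rw [prod_congr rfl fun e _ => h2 e, prod_add, powerset_univ, mul_sum]
  refine sum_congr rfl fun S _ => ?_
  have h3 : ∏ e : G.edgeSet, edgeFactor (edgeOp μ (S.map (Function.Embedding.subtype _))) x e =
      (∏ e ∈ S, edgeFactor (excitedOp μ) x e) * ∏ e ∈ univ \ S, edgeFactor (vacuumOp μ) x e := by
    rw [← prod_sdiff (subset_univ S), mul_comm]
    have hmem : ∀ e : G.edgeSet, s((edgeDart e).fst, (edgeDart e).snd) ∈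
        S.map (Function.Embedding.subtype _) ↔ e ∈ S := fun e => by
      rw [edgeDart_mk]
      exact mem_map' (Function.Embedding.subtype _)
    congr 1
    · refine prod_congr rfl fun e he => ?_
      rw [edgeFactor, edgeOp, if_pos ((hmem e).2 he)]
      rfl
    · refine prod_congr rfl fun e he => ?_
      rw [edgeFactor, edgeOp, if_neg (fun h => (mem_sdiff.1 he).2 ((hmem e).1 h))]
      rfl
  rw [h3, prod_mul_distrib, prod_const]
  ring

/-- Inserting the identity on every edge gives back the network. -/
theorem interpolatedPartition_one : interpolatedPartition T μ 1 = partitionFunction T := by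
  have hM : (fun v w => vacuumOp μ v w + ((1 : ℝ) : ℂ) • excitedOp μ v w) = fun _ _ => 1 := by
    ext v w : 2
    simp [excitedOp]
  rw [interpolatedPartition, hM, contractWith_eq, partitionFunction]
  symm
  refine Fintype.sum_of_injective (fun (y : G.edgeSet → Fin χ) (v : V) (w : G.neighborSet v) =>
    y ⟨s(v, w), mem_edgeSet_of_mem_neighborSet w.2⟩) ?_ _ _ ?_ ?_
  · intro y y' h
    ext ⟨e, he⟩
    induction e with
    | h a b => exact congrArg Fin.val (congrFun (congrFun h a) ⟨b, he⟩)
  · intro x hx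
    by_contra h0
    apply hx
    have h1 := fun e => prod_ne_zero_iff.1 (mul_ne_zero_iff.1 h0).2 e (mem_univ e)
    have h2 : ∀ (v w : V) (h : G.Adj v w), x v ⟨w, h⟩ = x w ⟨v, h.symm⟩ := by
      intro v w h
      have := h1 ⟨s(v, w), G.mem_edgeSet.2 h⟩
      rw [edgeFactor_mk (by simp)] at this
      by_contra hne
      exact this (Matrix.one_apply_ne hne)
    refine ⟨fun e => x (edgeDart e).fst ⟨(edgeDart e).snd, (edgeDart e).adj⟩, ?_⟩
    ext v ⟨w, h⟩ : 2
    have key : ∀ d : G.Dart, d.edge = s(v, w) → x d.fst ⟨d.snd, d.adj⟩ = x v ⟨w, h⟩ := by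
      rintro ⟨⟨a, b⟩, hab⟩ hd
      rcases Sym2.eq_iff.1 (show s(a, b) = s(v, w) from hd) with ⟨rfl, rfl⟩ | ⟨rfl, rfl⟩
      · rfl
      · exact h2 _ _ hab
    exact key _ (edgeDart_edge _)
  · intro y
    have : ∏ e : G.edgeSet, edgeFactor (fun _ _ => (1 : Matrix (Fin χ) (Fin χ) ℂ))
        (fun (v : V) (w : G.neighborSet v) =>
          y ⟨s(v, w), mem_edgeSet_of_mem_neighborSet w.2⟩) e = 1 := by
      refine prod_eq_one fun ⟨e, he⟩ _ => ?_
      induction e with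
      | h a b =>
        rw [edgeFactor_mk (by simp), Matrix.one_apply, if_pos]
        exact congrArg y (Subtype.ext Sym2.eq_swap)
    rw [this, mul_one]

theorem prod_edges_incident {M : Type*} [CommMonoid M] (f : G.edgeSet → M) (v : V) :
    ∏ e : G.edgeSet with v ∈ e.1, f e = ∏ w : G.neighborSet v,
      f ⟨s(v, w), mem_edgeSet_of_mem_neighborSet w.2⟩ := by
  symm
  refine prod_nbij (fun w : G.neighborSet v =>
    (⟨s(v, w), mem_edgeSet_of_mem_neighborSet w.2⟩ : G.edgeSet)) ?_ ?_ ?_ ?_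
  · intro w _
    simp
  · intro w _ w' _ h
    exact Subtype.ext (Sym2.congr_right.1 (congrArg Subtype.val h))
  · rintro ⟨e, he⟩ hv
    simp only [coe_filter, mem_univ, true_and, Set.mem_ofPred_eq] at hv
    obtain ⟨w, rfl⟩ := hv
    exact ⟨⟨w, he⟩, by simp, rfl⟩
  · exact fun _ _ => rfl

theorem sum_eq_zero_of_update {β : V → Type*} [∀ v, Fintype (β v)] (f : ((v : V) → β v) → ℂ)
    (v : V) (h : ∀ x, ∑ z, f (Function.update x v z) = 0) : ∑ x, f x = 0 := by
  have h1 : ∑ p : ((v : V) → β v) × β v, f (Function.update p.1 v p.2) =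
      ∑ p : ((v : V) → β v) × β v, f p.1 := by
    refine sum_nbij' (fun p => (Function.update p.1 v p.2, p.1 v))
      (fun p => (Function.update p.1 v p.2, p.1 v)) ?_ ?_ ?_ ?_ ?_ <;> simp
  rw [Fintype.sum_prod_type, Fintype.sum_prod_type, sum_congr rfl fun x _ => h x] at h1
  simp only [sum_const, smul_zero, card_univ, nsmul_eq_mul] at h1
  rw [← mul_sum] at h1
  rcases mul_eq_zero.1 h1.symm with h0 | h0
  · rw [Nat.cast_eq_zero, Fintype.card_eq_zero_iff] at h0
    have : IsEmpty ((v : V) → β v) := ⟨fun x => h0.elim (x v)⟩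
    simp
  · exact h0

variable {μ T}

/-- At a belief-propagation fixed point, a contraction with a dangling excited edge vanishes. -/
theorem edgeContraction_eq_zero (hBP : IsBPFixedPoint T μ)
    (hI : ∀ v w, G.Adj v w → overlap μ v w ≠ 0) {F : Finset (Sym2 V)} {v : V} (w : G.neighborSet v)
    (hw : s(v, (w : V)) ∈ F) (huniq : ∀ u : V, s(v, u) ∈ F → u = w) :
    edgeContraction μ T F = 0 := by
  rw [edgeContraction, contractWith_eq]
  refine sum_eq_zero_of_update _ v fun x => ?_
  obtain ⟨r, hr⟩ := hBP v w
  set A : ℂ := ∏ u ∈ univ.erase v, T u (x u) with hA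
  set B : ℂ := ∏ e : G.edgeSet with v ∉ e.1, edgeFactor (edgeOp μ F) x e with hB
  set C : ℂ := ∏ u ∈ univ.erase w, μ v u (x u ⟨v, u.2.symm⟩) / overlap μ v u with hC
  have hterm : ∀ z : G.neighborSet v → Fin χ,
      (∏ u, T u (Function.update x v z u)) *
        ∏ e : G.edgeSet, edgeFactor (edgeOp μ F) (Function.update x v z) e =
      (A * B * C) * (excitedOp μ v w (z w) (x w ⟨v, w.2.symm⟩) *
        (T v z * ∏ u ∈ univ.erase w, μ u v (z u))) := by
    intro z
    have h1 : ∏ u, T u (Function.update x v z u) = T v z * A := by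
      rw [← mul_prod_erase univ _ (mem_univ v), Function.update_self]
      congr 1
      refine prod_congr rfl fun u hu => ?_
      rw [Function.update_of_ne (mem_erase.1 hu).1]
    have h2 : ∏ e : G.edgeSet with v ∉ e.1, edgeFactor (edgeOp μ F) (Function.update x v z) e =
        B := by
      refine prod_congr rfl fun ⟨e, he⟩ hv => ?_
      have hv := (mem_filter.1 hv).2
      induction e with
      | h a b =>
        rw [edgeFactor_mk (edgeOp_transpose μ F), edgeFactor_mk (edgeOp_transpose μ F),
          Function.update_of_ne, Function.update_of_ne]
        · rintro rfl; exact hv (Sym2.mem_mk_right _ _)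
        · rintro rfl; exact hv (Sym2.mem_mk_left _ _)
    have h3 : ∏ e : G.edgeSet with v ∈ e.1, edgeFactor (edgeOp μ F) (Function.update x v z) e =
        excitedOp μ v w (z w) (x w ⟨v, w.2.symm⟩) * (C * ∏ u ∈ univ.erase w, μ u v (z u)) := by
      rw [prod_edges_incident, ← mul_prod_erase univ _ (mem_univ w), hC, ← prod_mul_distrib]
      have hfac : ∀ u : G.neighborSet v,
          edgeFactor (edgeOp μ F) (Function.update x v z)
            ⟨s(v, u), mem_edgeSet_of_mem_neighborSet u.2⟩ =
          edgeOp μ F v u (z u) (x u ⟨v, u.2.symm⟩) := by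
        intro u
        rw [edgeFactor_mk (edgeOp_transpose μ F), Function.update_self, Function.update_of_ne]
        exact (G.ne_of_adj u.2).symm
      congr 1
      · rw [hfac, edgeOp, if_pos hw]
      · refine prod_congr rfl fun u hu => ?_
        rw [hfac, edgeOp, if_neg, vacuumOp_apply]
        · ring
        · exact fun h => (mem_erase.1 hu).1 (Subtype.ext (huniq u h))
    rw [h1, ← prod_filter_mul_prod_filter_not univ (fun e : G.edgeSet => v ∈ e.1), h2, h3]
    ring
  rw [sum_congr rfl fun z _ => hterm z, ← mul_sum]
  have hsum : ∑ z : G.neighborSet v → Fin χ, excitedOp μ v w (z w) (x w ⟨v, w.2.symm⟩) *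
      (T v z * ∏ u ∈ univ.erase w, μ u v (z u)) = 0 := by
    rw [← sum_fiberwise univ (fun z : G.neighborSet v → Fin χ => z w)]
    have hi : ∀ i : Fin χ, ∑ z : G.neighborSet v → Fin χ with z w = i,
        excitedOp μ v w (z w) (x w ⟨v, w.2.symm⟩) * (T v z * ∏ u ∈ univ.erase w, μ u v (z u)) =
        r * (μ v w i * excitedOp μ v w i (x w ⟨v, w.2.symm⟩)) := by
      intro i
      rw [← mul_assoc, ← hr i, sum_mul]
      refine sum_congr rfl fun z hz => ?_
      rw [(mem_filter.1 hz).2, mul_comm]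
    rw [sum_congr rfl fun i _ => hi i, ← mul_sum, sum_mul_excitedOp (hI v w w.2), mul_zero]
  rw [hsum, mul_zero]

/-- Contractions factorize over vertex-disjoint sets of excited edges: the vacuum on the edges
between the two sets has rank one, so the indices of two copies of the network may be exchanged
outside `S`. -/
theorem edgeContraction_mul (S : Set V) {F₁ F₂ : Finset (Sym2 V)}
    (h₁ : ∀ a b, s(a, b) ∈ F₁ → a ∈ S) (h₂ : ∀ a b, s(a, b) ∈ F₂ → a ∉ S) :
    edgeContraction μ T F₁ * edgeContraction μ T F₂ =
      edgeContraction μ T (F₁ ∪ F₂) * edgeContraction μ T ∅ := by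
  classical
  simp only [edgeContraction, contractWith_eq]
  rw [sum_mul_sum, sum_mul_sum, ← Fintype.sum_prod_type', ← Fintype.sum_prod_type']
  refine sum_nbij' (fun p => (S.piecewise p.1 p.2, S.piecewise p.2 p.1))
      (fun p => (S.piecewise p.1 p.2, S.piecewise p.2 p.1)) (by simp) (by simp) ?_ ?_ ?_
  · rintro ⟨x, y⟩ _
    ext v : 2 <;> by_cases hv : v ∈ S <;> simp [hv]
  · rintro ⟨x, y⟩ _
    ext v : 2 <;> by_cases hv : v ∈ S <;> simp [hv]
  · rintro ⟨x, y⟩ _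
    dsimp only
    have hT : (∏ v, T v (x v)) * ∏ v, T v (y v) =
        (∏ v, T v (S.piecewise x y v)) * ∏ v, T v (S.piecewise y x v) := by
      rw [← prod_mul_distrib, ← prod_mul_distrib]
      refine prod_congr rfl fun v _ => ?_
      by_cases hv : v ∈ S <;> simp [hv, mul_comm]
    have hE : (∏ e : G.edgeSet, edgeFactor (edgeOp μ F₁) x e) *
        ∏ e : G.edgeSet, edgeFactor (edgeOp μ F₂) y e =
        (∏ e : G.edgeSet, edgeFactor (edgeOp μ (F₁ ∪ F₂)) (S.piecewise x y) e) *
          ∏ e : G.edgeSet, edgeFactor (edgeOp μ ∅) (S.piecewise y x) e := by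
      rw [← prod_mul_distrib, ← prod_mul_distrib]
      refine prod_congr rfl fun ⟨e, he⟩ _ => ?_
      induction e with
      | h a b =>
        have hs : s(a, b) = s(b, a) := Sym2.eq_swap
        simp only [edgeFactor_mk (edgeOp_transpose μ _)]
        simp only [edgeOp, mem_union, notMem_empty, if_false]
        by_cases ha : a ∈ S <;> by_cases hb : b ∈ S
        · have n2 : s(a, b) ∉ F₂ := fun h => h₂ a b h ha
          simp [ha, hb, n2]
        · have n1 : s(a, b) ∉ F₁ := fun h => hb (h₁ b a (hs ▸ h))
          have n2 : s(a, b) ∉ F₂ := fun h => h₂ a b h ha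
          simp only [ha, hb, n1, n2, or_self, if_false, Set.piecewise_eq_of_mem,
            Set.piecewise_eq_of_notMem, not_false_eq_true, vacuumOp_apply]
          ring
        · have n1 : s(a, b) ∉ F₁ := fun h => ha (h₁ a b h)
          have n2 : s(a, b) ∉ F₂ := fun h => h₂ b a (hs ▸ h) hb
          simp only [ha, hb, n1, n2, or_self, if_false, Set.piecewise_eq_of_mem,
            Set.piecewise_eq_of_notMem, not_false_eq_true, vacuumOp_apply]
          ring
        · have n1 : s(a, b) ∉ F₁ := fun h => ha (h₁ a b h)
          simp [ha, hb, n1, mul_comm]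
    calc _ = ((∏ v, T v (x v)) * ∏ v, T v (y v)) *
          ((∏ e : G.edgeSet, edgeFactor (edgeOp μ F₁) x e) *
            ∏ e : G.edgeSet, edgeFactor (edgeOp μ F₂) y e) := by ring
      _ = _ := by rw [hT, hE]; ring

theorem prod_darts {M : Type*} [CommMonoid M] (g : (v w : V) → G.Adj v w → M) :
    ∏ e : G.edgeSet, (g _ _ (edgeDart e).adj * g _ _ (edgeDart e).adj.symm) =
      ∏ v, ∏ w : G.neighborSet v, g v w w.2 := by
  have h1 : ∏ v, ∏ w : G.neighborSet v, g v w w.2 = ∏ d : G.Dart, g d.fst d.snd d.adj := by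
    rw [prod_sigma' univ (fun v => (univ : Finset (G.neighborSet v))) fun v w => g v w w.2]
    exact prod_nbij' (fun p => ⟨(p.1, p.2.1), p.2.2⟩) (fun d => ⟨d.fst, ⟨d.snd, d.adj⟩⟩)
      (by simp) (by simp) (fun _ _ => rfl) (fun _ _ => rfl) (fun _ _ => rfl)
  rw [h1, ← prod_fiberwise univ fun d : G.Dart => (⟨d.edge, d.edge_mem⟩ : G.edgeSet)]
  refine prod_congr rfl fun e _ => ?_
  have h2 : (univ.filter fun d : G.Dart => (⟨d.edge, d.edge_mem⟩ : G.edgeSet) = e) =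
      {edgeDart e, (edgeDart e).symm} := by
    rw [← SimpleGraph.Dart.edge_fiber]
    ext d
    simp [Subtype.ext_iff, edgeDart_edge]
  rw [h2, prod_pair (SimpleGraph.Dart.symm_ne _).symm]
  rfl

/-- The vacuum contribution of the normalized network is `1`. -/
theorem edgeContraction_empty (hZ : ∀ v, localContribution T μ v ≠ 0) :
    edgeContraction μ (normalize T μ) ∅ = 1 := by
  rw [edgeContraction, contractWith_eq]
  have hedge : ∀ x : (v : V) → G.neighborSet v → Fin χ,
      ∏ e : G.edgeSet, edgeFactor (edgeOp μ ∅) x e =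
      ∏ v, ∏ w : G.neighborSet v, (μ w v (x v w) / (overlap μ v w) ^ (1 / 2 : ℂ)) := by
    intro x
    rw [← prod_darts fun v w h => μ w v (x v ⟨w, h⟩) / (overlap μ v w) ^ (1 / 2 : ℂ)]
    refine prod_congr rfl fun e _ => ?_
    rw [edgeFactor, edgeOp, if_neg (notMem_empty _), vacuumOp_apply,
      overlap_comm μ (edgeDart e).snd (edgeDart e).fst, div_mul_div_comm]
    congr 1
    rw [← pow_two, ← Complex.cpow_nat_mul]
    norm_num
  simp only [hedge, ← prod_mul_distrib]
  rw [← Fintype.piFinset_univ, ← prod_univ_sum (fun v => (univ : Finset (G.neighborSet v → Fin χ)))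
    fun v z => normalize T μ v z *
      ∏ w : G.neighborSet v, (μ w v (z w) / (overlap μ v w) ^ (1 / 2 : ℂ))]
  refine prod_eq_one fun v _ => ?_
  simp only [normalize, div_mul_eq_mul_div]
  rw [← sum_div]
  exact div_self (hZ v)

theorem isBPFixedPoint_normalize (hBP : IsBPFixedPoint T μ) :
    IsBPFixedPoint (normalize T μ) μ := by
  intro v w
  obtain ⟨r, hr⟩ := hBP v w
  refine ⟨r / localContribution T μ v, fun i => ?_⟩
  rw [div_mul_eq_mul_div, ← hr i, sum_div]
  refine sum_congr rfl fun x _ => ?_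
  rw [normalize, div_mul_eq_mul_div]

end Contraction

/-! ### The network as a gas of loops -/

section LoopGas

variable {V : Type*} {G : SimpleGraph V}

/-- Two loops are incompatible if they share a vertex. -/
def Incompatible (l l' : Loop G) : Prop := ¬ Compatible l l'

theorem incompatible_iff {l l' : Loop G} :
    Incompatible l l' ↔ ∃ a, a ∈ l.1.verts ∧ a ∈ l'.1.verts := by
  rw [Incompatible, Compatible, Set.not_disjoint_iff]

theorem incompatible_refl (l : Loop G) : Incompatible l l := by
  obtain ⟨⟨v, hv⟩⟩ := l.2.2.coe.nonempty
  exact incompatible_iff.2 ⟨v, hv, hv⟩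

theorem incompatible_symm (l l' : Loop G) (h : Incompatible l l') : Incompatible l' l := by
  obtain ⟨a, h1, h2⟩ := incompatible_iff.1 h
  exact incompatible_iff.2 ⟨a, h2, h1⟩

/-- The loop `l` is a connected component of the edge set `F`. -/
structure IsComponent (F : Finset (Sym2 V)) (l : Loop G) : Prop where
  mem : ∀ a b, l.1.Adj a b → s(a, b) ∈ F
  adj : ∀ a b, a ∈ l.1.verts → s(a, b) ∈ F → l.1.Adj a b

theorem IsComponent.eq {F : Finset (Sym2 V)} {l l' : Loop G} (h : IsComponent F l)
    (h' : IsComponent F l') (hi : Incompatible l l') : l = l' := by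
  obtain ⟨a, ha, ha'⟩ := incompatible_iff.1 hi
  have key : ∀ m m' : Loop G, IsComponent F m → IsComponent F m' → a ∈ m.1.verts →
      a ∈ m'.1.verts → m.1.verts ⊆ m'.1.verts := fun m m' hm hm' hma hma' =>
    verts_subset_of_closed m.2.2 hma hma' fun x y hxy hx =>
      (hm'.adj x y hx (hm.mem x y hxy)).snd_mem
  have hv : l.1.verts = l'.1.verts :=
    (key l l' h h' ha ha').antisymm (key l' l h' h ha' ha)
  refine Subtype.ext (SimpleGraph.Subgraph.ext hv ?_)
  ext x y
  exact ⟨fun hxy => h'.adj x y (hv ▸ hxy.fst_mem) (h.mem x y hxy),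
    fun hxy => h.adj x y (hv ▸ hxy.fst_mem) (h'.mem x y hxy)⟩

variable [Fintype V]

/-- An edge of a set without vertices of degree one lies in a connected component that is a
loop. -/
theorem exists_isComponent [DecidableEq V] {F : Finset (Sym2 V)} (hF : ∀ e ∈ F, e ∈ G.edgeSet)
    (hdeg : ∀ v w, s(v, w) ∈ F → ∃ u, u ≠ w ∧ s(v, u) ∈ F) {a b : V} (hab : s(a, b) ∈ F) :
    ∃ l : Loop G, IsComponent F l ∧ l.1.Adj a b := by
  have hreach : ∀ x ∈ reach F a, ∃ y, s(x, y) ∈ F := fun x hx =>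
    hx {x | ∃ y, s(x, y) ∈ F} ⟨b, hab⟩ fun x y hxy _ => ⟨x, by rwa [Sym2.eq_swap]⟩
  let C : G.Subgraph :=
    { verts := reach F a
      Adj := fun x y => x ∈ reach F a ∧ s(x, y) ∈ F
      adj_sub := fun h => hF _ h.2
      edge_vert := fun h => h.1
      symm := ⟨fun x y h => ⟨reach_closed h.2 h.1, by rw [Sym2.eq_swap]; exact h.2⟩⟩ }
  have hloop : IsGeneralizedLoop C := by
    intro x hx
    obtain ⟨y, hy⟩ := hreach x hx
    obtain ⟨z, hz, hz'⟩ := hdeg x y hy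
    rw [← Set.ncard_pair hz]
    refine Set.ncard_le_ncard ?_ (Set.toFinite _)
    rintro w (rfl | rfl)
    exacts [⟨hx, hz'⟩, ⟨hx, hy⟩]
  have hconn : C.Connected := by
    have ha : a ∈ C.verts := self_mem_reach F a
    have hr : ∀ x ∈ reach F a, ∃ hx : x ∈ C.verts, C.coe.Reachable ⟨a, ha⟩ ⟨x, hx⟩ := by
      intro x hx
      refine hx {x | ∃ hx : x ∈ C.verts, C.coe.Reachable ⟨a, ha⟩ ⟨x, hx⟩} ⟨ha, .refl _⟩ ?_
      rintro x y hxy ⟨hx, hax⟩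
      refine ⟨reach_closed hxy hx, hax.trans (SimpleGraph.Adj.reachable ?_)⟩
      exact ⟨hx, hxy⟩
    have : Nonempty C.verts := ⟨⟨a, ha⟩⟩
    exact ⟨⟨fun x y => (hr x x.2).2.symm.trans (hr y y.2).2⟩⟩
  exact ⟨⟨C, hloop, hconn⟩, ⟨fun x y h => h.2, fun x y hx h => ⟨hx, h⟩⟩, self_mem_reach F a, hab⟩

theorem pairwise_disjoint_edges {W : Loop G →₀ ℕ} (hW : Indep Incompatible W) :
    (W.support : Set (Loop G)).PairwiseDisjoint Loop.edges := by
  intro l hl l' hl' hne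
  rw [Function.onFun, disjoint_left]
  intro e he he'
  induction e with
  | h a b =>
    exact hne (hW.2 l l' (Finsupp.mem_support_iff.1 hl) (Finsupp.mem_support_iff.1 hl')
      (incompatible_iff.2 ⟨a, (l.mem_edges.1 he).fst_mem, (l'.mem_edges.1 he').fst_mem⟩))

variable [DecidableEq V]

/-- The union of the edges of the loops in a cluster. -/
noncomputable def unionEdges (W : Loop G →₀ ℕ) : Finset (Sym2 V) := W.support.biUnion Loop.edges

theorem mk_mem_unionEdges {W : Loop G →₀ ℕ} {a b : V} :
    s(a, b) ∈ unionEdges W ↔ ∃ l, W l ≠ 0 ∧ l.1.Adj a b := by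
  simp [unionEdges, Loop.mem_edges]

theorem isComponent_unionEdges {W : Loop G →₀ ℕ} (hW : Indep Incompatible W) {l : Loop G}
    (hl : W l ≠ 0) : IsComponent (unionEdges W) l where
  mem a b h := mk_mem_unionEdges.2 ⟨l, hl, h⟩
  adj a b ha h := by
    obtain ⟨l', hl', h'⟩ := mk_mem_unionEdges.1 h
    rwa [hW.2 l l' hl hl' (incompatible_iff.2 ⟨a, ha, h'.fst_mem⟩)]

theorem unionEdges_injOn :
    Set.InjOn (unionEdges : (Loop G →₀ ℕ) → _) {W | Indep Incompatible W} := by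
  have key : ∀ W W' : Loop G →₀ ℕ, Indep Incompatible W → Indep Incompatible W' →
      unionEdges W = unionEdges W' → ∀ l, W l ≠ 0 → W' l ≠ 0 := by
    intro W W' hW hW' h l hl
    obtain ⟨⟨a, ha⟩⟩ := l.2.2.coe.nonempty
    obtain ⟨b, hb⟩ := l.exists_adj ha
    have hc := isComponent_unionEdges hW hl
    have hab := hc.mem a b hb
    rw [h] at hab hc
    obtain ⟨l', hl', hb'⟩ := mk_mem_unionEdges.1 hab
    rwa [hc.eq (isComponent_unionEdges hW' hl') (incompatible_iff.2 ⟨a, ha, hb'.fst_mem⟩)]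
  intro W hW W' hW' h
  ext l
  have h1 := hW.1 l
  have h2 := hW'.1 l
  have h3 := key W W' hW hW' h l
  have h4 := key W' W hW' hW h.symm l
  omega

theorem exists_unionEdges_eq {F : Finset (Sym2 V)} (hF : ∀ e ∈ F, e ∈ G.edgeSet)
    (hdeg : ∀ v w, s(v, w) ∈ F → ∃ u, u ≠ w ∧ s(v, u) ∈ F) :
    ∃ W : Loop G →₀ ℕ, Indep Incompatible W ∧ unionEdges W = F := by
  classical
  have := Fintype.ofFinite (Loop G)
  let W : Loop G →₀ ℕ := Finsupp.equivFunOnFinite.symm fun l => if IsComponent F l then 1 else 0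
  have hW : ∀ l, W l ≠ 0 ↔ IsComponent F l := fun l => by simp [W]
  refine ⟨W, ⟨fun l => ?_, fun l l' hl hl' hi => ((hW l).1 hl).eq ((hW l').1 hl') hi⟩, ?_⟩
  · simp only [W, Finsupp.equivFunOnFinite_symm_apply_apply]
    split_ifs <;> omega
  · ext e
    induction e with
    | h a b =>
      rw [mk_mem_unionEdges]
      constructor
      · rintro ⟨l, hl, h⟩
        exact ((hW l).1 hl).mem a b h
      · intro h
        obtain ⟨l, hl, hadj⟩ := exists_isComponent hF hdeg h
        exact ⟨l, (hW l).2 hl, hadj⟩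

theorem card_unionEdges [Fintype (Loop G)] {W : Loop G →₀ ℕ} (hW : Indep Incompatible W) :
    card (unionEdges W) = ∑ l, W l * l.weight := by
  rw [unionEdges, card_biUnion (pairwise_disjoint_edges hW)]
  refine (sum_congr rfl fun l hl => ?_).trans (sum_subset (subset_univ W.support) fun l _ hl => ?_)
  · have h1 := hW.1 l
    have h2 := Finsupp.mem_support_iff.1 hl
    rw [l.card_edges, show W l = 1 by omega, one_mul]
  · rw [Finsupp.notMem_support_iff.1 hl, zero_mul]

variable {χ : ℕ} [DecidableRel G.Adj] {T : Network G χ} {μ : Messages V χ}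

theorem edgeContraction_biUnion (hT : edgeContraction μ T ∅ = 1) (s : Finset (Loop G))
    (hs : ∀ l ∈ s, ∀ l' ∈ s, Incompatible l l' → l = l') :
    edgeContraction μ T (s.biUnion Loop.edges) = ∏ l ∈ s, loopCorrection T μ l := by
  classical
  induction s using Finset.induction_on with
  | empty => simpa using hT
  | insert l s hl ih =>
    rw [biUnion_insert, prod_insert hl, ← ih fun m hm m' hm' =>
      hs m (mem_insert_of_mem hm) m' (mem_insert_of_mem hm'), loopCorrection_eq,
      edgeContraction_mul l.1.verts, hT, mul_one]
    · exact fun a b h => (l.mem_edges.1 h).fst_mem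
    · intro a b h ha
      obtain ⟨m, hm, hab⟩ := mem_biUnion.1 h
      have := hs l (mem_insert_self _ _) m (mem_insert_of_mem hm)
        (incompatible_iff.2 ⟨a, ha, (m.mem_edges.1 hab).fst_mem⟩)
      exact hl (this ▸ hm)

theorem edgeContraction_unionEdges [Fintype (Loop G)] (hT : edgeContraction μ T ∅ = 1)
    {W : Loop G →₀ ℕ}
    (hW : Indep Incompatible W) :
    edgeContraction μ T (unionEdges W) = monom (loopCorrection T μ) W := by
  rw [unionEdges, edgeContraction_biUnion hT W.support fun l hl l' hl' =>
    hW.2 l l' (Finsupp.mem_support_iff.1 hl) (Finsupp.mem_support_iff.1 hl'), monom]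
  refine (prod_congr rfl fun l hl => ?_).trans
    (prod_subset (subset_univ W.support) fun l _ hl => ?_)
  · have h1 := hW.1 l
    have h2 := Finsupp.mem_support_iff.1 hl
    rw [show W l = 1 by omega, pow_one]
  · rw [Finsupp.notMem_support_iff.1 hl, pow_zero]

/-- At a belief-propagation fixed point with vacuum contribution `1`, the network is a hard-core
gas of connected loops. -/
theorem interpolatedPartition_eq_gas [Fintype (Loop G)] (hBP : IsBPFixedPoint T μ)
    (hI : ∀ v w, G.Adj v w → overlap μ v w ≠ 0) (hT : edgeContraction μ T ∅ = 1) (t : ℝ) :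
    interpolatedPartition T μ t =
      ∑ W ∈ (finite_indep (Incompatible (G := G))).toFinset,
        monom (loopCorrection T μ) W * (t : ℂ) ^ (∑ l, W l * l.weight) := by
  classical
  rw [interpolatedPartition_eq]
  have hmem : ∀ {W : Loop G →₀ ℕ}, W ∈ (finite_indep (Incompatible (G := G))).toFinset ↔
      Indep Incompatible W := fun {W} => Set.Finite.mem_toFinset _
  have hinj : Set.InjOn (unionEdges : (Loop G →₀ ℕ) → _)
      (finite_indep (Incompatible (G := G))).toFinset := fun W hW W' hW' h =>
    unionEdges_injOn (hmem.1 hW) (hmem.1 hW') h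
  have h1 : ∑ W ∈ (finite_indep (Incompatible (G := G))).toFinset,
        monom (loopCorrection T μ) W * (t : ℂ) ^ (∑ l, W l * l.weight) =
      ∑ F ∈ (finite_indep (Incompatible (G := G))).toFinset.image unionEdges,
        (t : ℂ) ^ card F * edgeContraction μ T F := by
    rw [sum_image hinj]
    refine sum_congr rfl fun W hW => ?_
    rw [card_unionEdges (hmem.1 hW), edgeContraction_unionEdges hT (hmem.1 hW), mul_comm]
  rw [h1]
  symm
  refine sum_subset ?_ fun F hF hF' => ?_
  · intro F hF
    obtain ⟨W, -, rfl⟩ := mem_image.1 hF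
    rw [mem_powerset]
    intro e he
    induction e with
    | h a b =>
      obtain ⟨l, -, hl⟩ := mk_mem_unionEdges.1 he
      exact SimpleGraph.mem_edgeFinset.2 hl.adj_sub
  · have hF := mem_powerset.1 hF
    by_cases hdeg : ∀ v w, s(v, w) ∈ F → ∃ u, u ≠ w ∧ s(v, u) ∈ F
    · obtain ⟨W, hW, rfl⟩ := exists_unionEdges_eq
        (fun e he => SimpleGraph.mem_edgeFinset.1 (hF he)) hdeg
      exact absurd (mem_image_of_mem _ (hmem.2 hW)) hF'
    · push Not at hdeg
      obtain ⟨v, w, hvw, huniq⟩ := hdeg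
      have hadj : w ∈ G.neighborSet v := SimpleGraph.mem_edgeFinset.1 (hF hvw)
      rw [edgeContraction_eq_zero hBP hI ⟨w, hadj⟩ hvw fun u hu => ?_, mul_zero]
      by_contra hne
      exact huniq u hne hu

end LoopGas

/-! ### The loop cluster expansion of a tensor network -/

section LogBranch

/-- A continuous logarithm along `[0, 1]` is determined by its initial value. -/
theorem eq_of_exp_eq {L L' : ℝ → ℂ} (hL : ContinuousOn L (Set.Icc 0 1))
    (hL' : ContinuousOn L' (Set.Icc 0 1)) (h0 : L 0 = L' 0)
    (h : ∀ t ∈ Set.Icc (0 : ℝ) 1, Complex.exp (L t) = Complex.exp (L' t)) : L 1 = L' 1 := by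
  have hcount : {w : ℂ | Complex.exp w = 1}.Countable := by
    refine (Set.countable_range fun n : ℤ => (n : ℂ) * (2 * Real.pi * Complex.I)).mono
      fun w hw => ?_
    obtain ⟨n, hn⟩ := Complex.exp_eq_one_iff.1 hw
    exact ⟨n, hn.symm⟩
  have hsub : (fun t => L t - L' t) '' Set.Icc 0 1 ⊆ {w : ℂ | Complex.exp w = 1} := by
    rintro _ ⟨t, ht, rfl⟩
    change Complex.exp (L t - L' t) = 1
    rw [Complex.exp_sub, h t ht, div_self (Complex.exp_ne_zero _)]
  have := hcount.isTotallyDisconnected _ hsub (isPreconnected_Icc.image _ (hL.sub hL'))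
    (Set.mem_image_of_mem _ (Set.left_mem_Icc.2 zero_le_one))
    (Set.mem_image_of_mem _ (Set.right_mem_Icc.2 zero_le_one))
  rw [h0, sub_self] at this
  exact sub_eq_zero.1 this.symm

end LogBranch

section Clusters

variable {V : Type*} {G : SimpleGraph V}

theorem Cluster.weight_eq [Fintype (Loop G)] (W : Cluster G) :
    W.weight = ∑ l, W l * Loop.weight l :=
  Finsupp.sum_fintype _ _ fun _ => zero_mul _

theorem Cluster.fact_eq [Fintype (Loop G)] (W : Cluster G) : W.fact = ∏ l, (W l)! :=
  Finsupp.prod_fintype _ _ fun _ => rfl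

theorem Cluster.correction_eq [Fintype V] [DecidableEq V] [Fintype (Loop G)] [DecidableRel G.Adj]
    {χ : ℕ} (T : Network G χ) (μ : Messages V χ) (W : Cluster G) :
    W.correction T μ = monom (loopCorrection T μ) W :=
  Finsupp.prod_fintype _ _ fun _ => pow_zero _

theorem Cluster.connSum_interactionGraph (W : Cluster G) [Fintype (Loop G)] :
    connSum W.interactionGraph = connSum (clusterGraph Incompatible W) := by
  let f : W.Vert ≃ Σ l : Loop G, Fin (W l) :=
    { toFun := fun p => ⟨p.1, p.2⟩
      invFun := fun p => ⟨⟨p.1, Finsupp.mem_support_iff.2 fun h => (h ▸ p.2).elim0⟩, p.2⟩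
      left_inv := fun _ => rfl
      right_inv := fun _ => rfl }
  rw [← connSum_comap_equiv f]
  congr 1
  ext p q
  rw [SimpleGraph.comap_adj, clusterGraph, SimpleGraph.fromRel_adj, f.injective.ne_iff]
  have hs : ∀ p q : W.Vert, p.1 = q.1 ∨ ¬ Compatible p.1.1 q.1.1 ↔
      (f p).1 = (f q).1 ∨ Incompatible (f p).1 (f q).1 := fun p q => by
    rw [Subtype.ext_iff]; rfl
  change p ≠ q ∧ (p.1 = q.1 ∨ ¬ Compatible p.1.1 q.1.1) ↔ _
  rw [hs]
  refine and_congr_right fun _ => ⟨Or.inl, ?_⟩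
  rintro (h | h)
  · exact h
  · exact h.imp Eq.symm (incompatible_symm _ _)

theorem Cluster.ursell_eq [Fintype (Loop G)] (W : Cluster G) :
    W.ursell = ursellCoeff Incompatible W := by
  rw [ursellCoeff, ← W.connSum_interactionGraph, ← W.fact_eq, div_eq_mul_one_div, mul_comm,
    Cluster.ursell, connSum]
  refine congrArg _ (sum_congr ?_ fun _ _ => rfl)
  ext E
  rw [mem_connSets]
  simp

theorem Cluster.isConnected_of_ursell_ne_zero {W : Cluster G} (h : W.ursell ≠ 0) :
    W.IsConnected := by
  classical
  obtain ⟨E, hE, -⟩ := exists_ne_zero_of_sum_ne_zero (right_ne_zero_of_mul h)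
  obtain ⟨-, hE, hc⟩ := mem_filter.1 hE
  refine hc.mono fun a b hab => ?_
  exact hE _ ((SimpleGraph.fromEdgeSet_adj _).1 hab).1

theorem Cluster.ursell_im (W : Cluster G) : W.ursell.im = 0 := by
  classical
  rw [← Complex.conj_eq_iff_im, Cluster.ursell]
  simp

open Classical in
/-- The Kotecký–Preiss condition for the loops of a graph of maximal degree `D + 1`. -/
theorem koteckyPreiss_loops [Fintype V] [DecidableEq V] [Fintype (Loop G)] {D : ℕ} (hD : 1 ≤ D)
    (hG : ∀ u, card (univ.filter fun w => G.Adj u w) ≤ D + 1) (S : Set V) :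
    ∑ l : Loop G with ∃ a, a ∈ S ∧ a ∈ l.1.verts,
      Real.exp (-(Real.log (2 * D) + 1 / 2) * l.weight) * Real.exp ((l.1.verts.ncard : ℝ) / 2) ≤
      (S.ncard : ℝ) / 2 := by
  set f : Loop G → ℝ := fun l => Real.exp (-(Real.log (2 * D) + 1 / 2) * l.weight) *
    Real.exp ((l.1.verts.ncard : ℝ) / 2) with hf
  have h1 : ∑ l : Loop G with ∃ a, a ∈ S ∧ a ∈ l.1.verts, f l ≤
      ∑ v ∈ S.toFinset, ∑ l : Loop G with v ∈ l.1.verts, f l := by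
    simp only [sum_filter]
    rw [sum_comm]
    refine sum_le_sum fun l _ => ?_
    have hnn : ∀ v ∈ S.toFinset, 0 ≤ if v ∈ l.1.verts then f l else 0 := fun v _ => by
      split_ifs <;> positivity
    split_ifs with h
    · obtain ⟨a, haS, ha⟩ := h
      have := single_le_sum hnn (Set.mem_toFinset.2 haS)
      rwa [if_pos ha] at this
    · exact sum_nonneg hnn
  refine h1.trans ((sum_le_sum fun v _ => sum_loops_through_le hD hG v).trans (le_of_eq ?_))
  rw [sum_const, Set.ncard_eq_toFinset_card', nsmul_eq_mul]
  ring

end Clusters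

section Convergence

variable {V : Type*} [Fintype V] [DecidableEq V] {G : SimpleGraph V}

/-- The activity `(2 D √e)^(-|l|)` of a loop at the boundary of the convergence region. -/
noncomputable def Loop.activity (D : ℕ) (l : Loop G) : ℝ :=
  Real.exp (-(Real.log (2 * D) + 1 / 2) * l.weight)

open Classical in
/-- Each connected cluster is counted at each of its loops, and each loop at each of its
vertices. -/
theorem summable_cluster_majorant [Fintype (Loop G)] {D : ℕ} (hD : 1 ≤ D)
    (hG : ∀ u, card (univ.filter fun w => G.Adj u w) ≤ D + 1) :
    (∀ y : Loop G, Summable fun W : Cluster G =>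
      (W y : ℝ) * ‖W.ursell‖ * monom (Loop.activity D) W) ∧
    Summable (fun W : Cluster G => ‖W.ursell‖ * monom (Loop.activity D) W) ∧
    ∑' W : Cluster G, ‖W.ursell‖ * monom (Loop.activity D) W ≤ Fintype.card V := by
  classical
  have hρ : ∀ l : Loop G, 0 ≤ Loop.activity D l := fun l => (Real.exp_pos _).le
  have hKP : ∀ x : Loop G, ∑ y with Incompatible x y, Loop.activity D y *
      Real.exp ((y.1.verts.ncard : ℝ) / 2) ≤ (x.1.verts.ncard : ℝ) / 2 := by
    intro x
    have := koteckyPreiss_loops hD hG x.1.verts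
    simp only [← incompatible_iff] at this
    exact this
  have hroot := fun y : Loop G => summable_rooted incompatible_refl incompatible_symm hρ hKP y
  simp only [← Cluster.ursell_eq] at hroot
  have hle : ∀ W : Cluster G, ‖W.ursell‖ * monom (Loop.activity D) W ≤
      ∑ y, (W y : ℝ) * ‖W.ursell‖ * monom (Loop.activity D) W := by
    intro W
    have hm := monom_nonneg hρ W
    have hnn : ∀ y, 0 ≤ (W y : ℝ) * ‖W.ursell‖ * monom (Loop.activity D) W := fun y => by
      positivity
    by_cases h : W = 0
    · rw [h, Cluster.ursell_eq, ursellCoeff_zero]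
      simp
    · obtain ⟨y, hy⟩ := Finsupp.ne_iff.1 h
      refine le_trans ?_ (single_le_sum (fun y _ => hnn y) (mem_univ y))
      rw [mul_assoc]
      refine le_mul_of_one_le_left (by positivity) ?_
      exact_mod_cast Nat.one_le_iff_ne_zero.2 hy
  have hsum := summable_sum fun y (_ : y ∈ univ) => (hroot y).1
  have hnn : ∀ W : Cluster G, 0 ≤ ‖W.ursell‖ * monom (Loop.activity D) W := fun W =>
    mul_nonneg (norm_nonneg _) (monom_nonneg hρ W)
  have hs := Summable.of_nonneg_of_le hnn hle hsum
  refine ⟨fun y => (hroot y).1, hs, (hs.tsum_le_tsum hle hsum).trans ?_⟩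
  rw [Summable.tsum_finsetSum fun y _ => (hroot y).1]
  refine (sum_le_sum fun y _ => (hroot y).2).trans ?_
  have hall := koteckyPreiss_loops hD hG (Set.univ : Set V)
  have hex : ∀ l : Loop G, ∃ a, a ∈ Set.univ ∧ a ∈ l.1.verts := fun l => by
    obtain ⟨⟨v, hv⟩⟩ := l.2.2.coe.nonempty
    exact ⟨v, Set.mem_univ v, hv⟩
  simp only [hex, filter_true] at hall
  rw [Set.ncard_univ, Nat.card_eq_fintype_card] at hall
  refine hall.trans ?_
  linarith [(Nat.cast_nonneg (Fintype.card V) : (0 : ℝ) ≤ _)]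

/-- The cluster expansion of a tensor network around a belief-propagation fixed point, on a graph of
maximal degree at most `D + 1`. -/
theorem cluster_expansion [DecidableRel G.Adj] {χ : ℕ} {T : Network G χ} {μ : Messages V χ}
    (hBP : IsBPFixedPoint T μ) (hI : ∀ v w, G.Adj v w → overlap μ v w ≠ 0)
    (hZ : ∀ v, localContribution T μ v ≠ 0)
    {D : ℕ} (hD : 1 ≤ D) (hdeg : ∀ v, G.degree v ≤ D + 1)
    {c d : ℝ} (hc : Real.log (2 * D) + 1 / 2 < c) (hd : d = c - Real.log (2 * D) - 1 / 2)
    (hdecay : ∀ l : Loop G,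
      ‖loopCorrection (normalize T μ) μ l‖ ≤ Real.exp (-c * (l.weight : ℝ))) :
    Summable (fun W : {W : Cluster G // W.IsConnected} =>
      ‖W.1.ursell * W.1.correction (normalize T μ) μ‖) ∧
    ∃ logZ : ℂ,
      (∀ z : ℂ, IsLogPartition (normalize T μ) μ z ↔ z = logZ) ∧
      Complex.exp logZ = partitionFunction (normalize T μ) ∧
      ((∀ l : Loop G, (loopCorrection (normalize T μ) μ l).im = 0) →
        ∃ Z : ℝ, 0 < Z ∧ partitionFunction (normalize T μ) = (Z : ℂ) ∧
          logZ = (Real.log Z : ℂ)) ∧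
      HasSum (fun W : {W : Cluster G // W.IsConnected} =>
        W.1.ursell * W.1.correction (normalize T μ) μ) logZ ∧
      ∀ m : ℕ, ‖logZ - truncatedExpansion (normalize T μ) μ m‖ ≤
        (Fintype.card V : ℝ) * Real.exp (-d * ((m : ℝ) + 1)) := by
  classical
  have hfin : Fintype (Loop G) := Fintype.ofFinite _
  have hd0 : 0 < d := by linarith
  set T' := normalize T μ with hT'
  set Zl : Loop G → ℂ := loopCorrection T' μ with hZl
  obtain ⟨hroot, hmaj, hmaj_le⟩ := summable_cluster_majorant (G := G) hD fun u => by
    have := hdeg u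
    rw [← SimpleGraph.card_neighborFinset_eq_degree] at this
    refine le_trans (card_le_card fun w hw => ?_) this
    simpa using hw
  -- the activities beat the decay of the loop corrections by a factor `exp (d |W|)`
  have hZle : ∀ W : Cluster G, ‖monom Zl W‖ ≤
      monom (Loop.activity D) W * Real.exp (-d * W.weight) := by
    intro W
    have h1 : monom (fun l : Loop G => Real.exp (-c * l.weight)) W =
        monom (Loop.activity D) W * Real.exp (-d * W.weight) := by
      simp only [monom, Cluster.weight_eq, Loop.activity, ← Real.exp_nat_mul, ← Real.exp_sum,
        ← Real.exp_add]
      congr 1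
      push_cast
      rw [mul_sum, ← sum_add_distrib]
      refine sum_congr rfl fun l _ => ?_
      rw [hd]
      ring
    rw [norm_monom, ← h1]
    exact monom_le_monom (fun _ => norm_nonneg _) hdecay W
  have hZle' : ∀ W : Cluster G, ‖monom Zl W‖ ≤ monom (Loop.activity D) W := fun W =>
    (hZle W).trans (mul_le_of_le_one_right (monom_nonneg (fun _ => (Real.exp_pos _).le) W)
      (Real.exp_le_one_iff.2 (by
        have : (0 : ℝ) ≤ W.weight := Nat.cast_nonneg _
        nlinarith)))
  set f : Cluster G → ℂ := fun W => W.ursell * W.correction T' μ with hf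
  have hfeq : ∀ W : Cluster G, f W = ursellCoeff Incompatible W * monom Zl W := fun W => by
    rw [hf, hZl]
    simp only
    rw [Cluster.ursell_eq, Cluster.correction_eq]
  have hfle : ∀ W, ‖f W‖ ≤ ‖W.ursell‖ * monom (Loop.activity D) W * Real.exp (-d * W.weight) := by
    intro W
    rw [hfeq, norm_mul, ← Cluster.ursell_eq, mul_assoc]
    exact mul_le_mul_of_nonneg_left (hZle W) (norm_nonneg _)
  have hfsum : Summable fun W => ‖f W‖ := by
    refine Summable.of_nonneg_of_le (fun _ => norm_nonneg _) (fun W => ?_) hmaj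
    rw [hfeq, norm_mul, ← Cluster.ursell_eq]
    exact mul_le_mul_of_nonneg_left (hZle' W) (norm_nonneg _)
  have hsupp : Function.support f ⊆ {W : Cluster G | W.IsConnected} := fun W hW =>
    Cluster.isConnected_of_ursell_ne_zero (left_ne_zero_of_mul hW)
  obtain ⟨hcont, hexp⟩ := exp_tsum_cluster (R := Incompatible) (k := Loop.weight)
    (fun l => l.weight_pos) Zl (fun y => by
      refine Summable.of_nonneg_of_le (fun _ => by positivity) (fun W => ?_) (hroot y)
      rw [← Cluster.ursell_eq]
      exact mul_le_mul_of_nonneg_left (hZle' W) (by positivity))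
  simp only [← hfeq] at hcont hexp
  set L : ℝ → ℂ := fun t => ∑' W : Cluster G, f W * (t : ℂ) ^ (∑ l, W l * l.weight) with hL
  have hgas : ∀ t ∈ Set.Icc (0 : ℝ) 1, Complex.exp (L t) = interpolatedPartition T' μ t := by
    intro t ht
    rw [interpolatedPartition_eq_gas (isBPFixedPoint_normalize hBP) hI (edgeContraction_empty hZ) t]
    exact hexp t ht
  have hL0 : L 0 = 0 := by
    rw [hL]
    refine (tsum_congr fun W => ?_).trans tsum_zero
    by_cases hW : W = 0
    · rw [hfeq, hW, ursellCoeff_zero, zero_mul, zero_mul]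
    · rw [Complex.ofReal_zero, zero_pow, mul_zero]
      intro h
      obtain ⟨y, hy⟩ := Finsupp.ne_iff.1 hW
      exact mul_ne_zero hy y.weight_pos.ne' (sum_eq_zero_iff.1 h y (mem_univ y))
  have hL1 : L 1 = ∑' W, f W := by simp [hL]
  have hexp1 : Complex.exp (L 1) = partitionFunction T' := by
    rw [hgas 1 (Set.right_mem_Icc.2 zero_le_one), interpolatedPartition_one]
  refine ⟨hfsum.subtype _, L 1, fun z => ⟨?_, ?_⟩, hexp1, ?_, ?_, fun m => ?_⟩
  · rintro ⟨L', hL'c, hL'0, hL', rfl⟩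
    exact eq_of_exp_eq hL'c hcont (hL'0.trans hL0.symm) fun t ht =>
      (hL' t ht).trans (hgas t ht).symm
  · rintro rfl
    exact ⟨L, hcont, hL0, hgas, rfl⟩
  · intro him
    have hreal : ∀ W, (f W).im = 0 := by
      intro W
      have h1 : ∀ l, (starRingEnd ℂ) (Zl l) = Zl l := fun l => Complex.conj_eq_iff_im.2 (him l)
      rw [← Complex.conj_eq_iff_im, hfeq, ← Cluster.ursell_eq, map_mul,
        Complex.conj_eq_iff_im.2 W.ursell_im, monom, map_prod]
      simp only [map_pow, h1]
    have hLre : L 1 = ((L 1).re : ℂ) := by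
      refine Complex.ext rfl ?_
      rw [Complex.ofReal_im, hL1, Complex.im_tsum hfsum.of_norm]
      simp [hreal]
    refine ⟨Real.exp (L 1).re, Real.exp_pos _, ?_, ?_⟩
    · rw [← hexp1, Complex.ofReal_exp, ← hLre]
    · rw [Real.log_exp, ← hLre]
  · rw [hL1]
    exact (hasSum_subtype_iff_of_support_subset hsupp).2 hfsum.of_norm.hasSum
  · -- clusters of weight greater than `m` carry the factor `exp (-d (m + 1))`
    set S := (Cluster.finite_weight_le (G := G) m).toFinset with hS
    have htr : truncatedExpansion T' μ m = ∑ W ∈ S, f W := by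
      rw [truncatedExpansion]
      refine sum_filter_of_ne fun W _ hW => ?_
      exact Cluster.isConnected_of_ursell_ne_zero (left_ne_zero_of_mul hW)
    rw [hL1, htr, ← hfsum.of_norm.sum_add_tsum_subtype_compl S, add_sub_cancel_left]
    have hS' : ∀ W : {W // W ∉ S}, m + 1 ≤ W.1.weight := by
      rintro ⟨W, hW⟩
      rw [hS, Set.Finite.mem_toFinset] at hW
      exact Nat.lt_of_not_le hW
    have hs1 : Summable fun W : {W // W ∉ S} => ‖f W.1‖ := hfsum.subtype _
    have hs2 : Summable fun W : {W // W ∉ S} =>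
        ‖W.1.ursell‖ * monom (Loop.activity D) W.1 * Real.exp (-d * ((m : ℝ) + 1)) :=
      (hmaj.subtype _).mul_right _
    calc ‖∑' W : {W // W ∉ S}, f W.1‖ ≤ ∑' W : {W // W ∉ S}, ‖f W.1‖ := norm_tsum_le_tsum_norm hs1
      _ ≤ ∑' W : {W // W ∉ S}, ‖W.1.ursell‖ * monom (Loop.activity D) W.1 *
          Real.exp (-d * ((m : ℝ) + 1)) := by
        refine hs1.tsum_le_tsum (fun W => (hfle W.1).trans ?_) hs2
        refine mul_le_mul_of_nonneg_left (Real.exp_le_exp.2 ?_)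
          (mul_nonneg (norm_nonneg _) (monom_nonneg (fun _ => (Real.exp_pos _).le) _))
        have : (m : ℝ) + 1 ≤ W.1.weight := by exact_mod_cast hS' W
        nlinarith
      _ = (∑' W : {W // W ∉ S}, ‖W.1.ursell‖ * monom (Loop.activity D) W.1) *
          Real.exp (-d * ((m : ℝ) + 1)) := tsum_mul_right
      _ ≤ _ := by
        refine mul_le_mul_of_nonneg_right (le_trans ?_ hmaj_le) (Real.exp_pos _).le
        exact hmaj.tsum_subtype_le _ _ fun W =>
          mul_nonneg (norm_nonneg _) (monom_nonneg (fun _ => (Real.exp_pos _).le) _)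

end Convergence

end TensorNet

theorem theorem2 {V : Type*} [Fintype V] [DecidableEq V] (G : SimpleGraph V) [DecidableRel G.Adj]
    (χ : ℕ) (T : TensorNet.Network G χ) (μ : TensorNet.Messages V χ)
    (hBP : TensorNet.IsBPFixedPoint T μ)
    (hI : ∀ v w, G.Adj v w → TensorNet.overlap μ v w ≠ 0)
    (hZ : ∀ v, TensorNet.localContribution T μ v ≠ 0)
    (Δ : ℕ) (hΔ : 2 ≤ Δ) (hdeg : ∀ v, G.degree v ≤ Δ)
    (c d : ℝ) (hc : Real.log (2 * ((Δ : ℝ) - 1)) + 1 / 2 < c)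
    (hd : d = c - Real.log (2 * ((Δ : ℝ) - 1)) - 1 / 2)
    (hdecay : ∀ l : TensorNet.Loop G,
      ‖TensorNet.loopCorrection (TensorNet.normalize T μ) μ l‖ ≤ Real.exp (-c * (l.weight : ℝ))) :
    Summable (fun W : {W : TensorNet.Cluster G // W.IsConnected} =>
      ‖W.1.ursell * W.1.correction (TensorNet.normalize T μ) μ‖) ∧
    ∃ logZ : ℂ,
      (∀ z : ℂ, TensorNet.IsLogPartition (TensorNet.normalize T μ) μ z ↔ z = logZ) ∧
      Complex.exp logZ = TensorNet.partitionFunction (TensorNet.normalize T μ) ∧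
      ((∀ l : TensorNet.Loop G,
          (TensorNet.loopCorrection (TensorNet.normalize T μ) μ l).im = 0) →
        ∃ Z : ℝ, 0 < Z ∧ TensorNet.partitionFunction (TensorNet.normalize T μ) = (Z : ℂ) ∧
          logZ = (Real.log Z : ℂ)) ∧
      HasSum (fun W : {W : TensorNet.Cluster G // W.IsConnected} =>
        W.1.ursell * W.1.correction (TensorNet.normalize T μ) μ) logZ ∧
      ∀ m : ℕ, ‖logZ - TensorNet.truncatedExpansion (TensorNet.normalize T μ) μ m‖ ≤
        (Fintype.card V : ℝ) * Real.exp (-d * ((m : ℝ) + 1)) := by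
  obtain ⟨D, rfl⟩ := Nat.exists_eq_add_of_le' (by omega : 1 ≤ Δ)
  have hcast : (((D + 1 : ℕ) : ℝ) - 1) = D := by push_cast; ring
  rw [hcast] at hc hd
  exact TensorNet.cluster_expansion hBP hI hZ (by omega) hdeg hc hd hdecay
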